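/- Let $q>2$ be a prime. For a prime $t>2$, $t\neq q$, let $X^{q,t}$ be the Davidoff--Sarnak--Valette Cayley graph, defined as follows. Let $D_q$ be the set of integer Hamilton quaternions $\alpha=a_0+a_1i+a_2j+a_3k$ with $a_0^2+a_1^2+a_2^2+a_3^2=q$, $a_0\ge 0$, $a_1\equiv a_2\equiv a_3\not\equiv a_0 \pmod 2$. Choose $x,y\in\mathbb F_t$ with $x^2+y^2+1=0$ and let $$\psi(\alpha)=\begin{pmatrix} a_0+a_1x+a_3y & -a_1y+a_2+a_3x\\ -a_1y-a_2+a_3x & a_0-a_1x-a_3y\end{pmatrix}\in GL_2(\mathbb F_t).$$ Let $S_{q,t}\subset PGL_2(\mathbb F_t)$ be the image of $\psi(D_q)$ (a symmetric set, with exactly $q+1$ elements when $t>2\sqrt q$), and let $G_{q,t}=PSL_2(\mathbb F_t)$ (seen inside $PGL_2(\mathbb F_t)$) if $q$ is a square modulo $t$, and $G_{q,t}=PGL_2(\mathbb F_t)$ otherwise; then $S_{q,t}\subset G_{q,t}$ and $X^{q,t}=\mathrm{Cay}(G_{q,t},S_{q,t})$. Let $q'$ be an integer with $q'+1\ge\sqrt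 q+1$, and let $\mathcal F$ be the family of all $(q'+1)$-regular Cayley graphs $X_t=\mathrm{Cay}(G_{q,t},S_t)$, where $t>2$ is a prime different from $q$ and $S_t\subseteq S_{q,t}$ is a symmetric subset ($S_t=S_t^{-1}$) with $|S_t|=q'+1$. Then $\mathcal F$ satisfies the Sarnak--Xue density property with parameter $A=1/3$: for every $\epsilon>0$ there is a constant $C$, depending only on $q$, $q'$ and $\epsilon$, such that for every $X\in\mathcal F$ and every $2<p\le\infty$, $$\#\{i:\ p_i\ge p\}\le C\, n^{\,1-\frac13\left(1-\frac2p\right)+\epsilon}.$$ Here $n$ is the number of vertices of $X$, $\lambda_0\ge\dots\ge\lambda_{n-1}$ are the eigenvalues, with multiplicity, of the normalized adjacency operator $Af(v)=\frac1{q'+1}\sum_{w\sim v}f(w)$ of $X$, and the $p$-value $p_i$ of $\lambda_i$ is $2$ if $|\lambda_i|\le\frac{2\sqrt{q'}}{q'+1}$, and otherwise is the unique $2<p_i\le\infty$ with $|\lambda_i|=\frac{1}{q'+1}\left(q'^{1/p_i}+q'^{1-1/p_i}\right)$, where $1/\infty=0$. -/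

import Mathlib

open scoped MatrixGroups Quaternion

noncomputable section

/-! ### Finite regular graphs, normalized adjacency operators and `p`-values -/

/-- A finite `d`-regular undirected graph, multiple edges and loops allowed:
`mult x y` is the number of edges from `x` to `y`. -/
structure FiniteRegularGraph (d : ℕ) where
  V : Type
  [fintypeV : Fintype V]
  [decEqV : DecidableEq V]
  mult : V → V → ℕ
  mult_symm : ∀ x y, mult x y = mult y x
  degree_eq : ∀ x, ∑ y, mult x y = d

namespace FiniteRegularGraph

attribute [instance] FiniteRegularGraph.fintypeV FiniteRegularGraph.decEqV

variable {d : ℕ} (X : FiniteRegularGraph d)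

/-- The number of vertices. -/
def order : ℕ := Fintype.card X.V

/-- The matrix of the normalized adjacency operator `A f (x) = d⁻¹ ∑_{y ∼ x} f y`. -/
def adjOp : Matrix X.V X.V ℝ := Matrix.of fun x y => (X.mult x y : ℝ) / d

theorem adjOp_isHermitian : X.adjOp.IsHermitian := by
  ext x y
  simp [adjOp, X.mult_symm x y]

/-- The eigenvalues of the normalized adjacency operator, listed with multiplicity
(the list is indexed by the vertices). -/
def eigenvalue : X.V → ℝ := X.adjOp_isHermitian.eigenvalues

end FiniteRegularGraph

/-- `p ∈ [2, ∞]` is the `p`-value of the eigenvalue `l` of a `(q + 1)`-regular graph: `p = 2` if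
`|l| ≤ 2 √q / (q + 1)`, and otherwise `2 < p ≤ ∞` and
`|l| = (q ^ (1 / p) + q ^ (1 - 1 / p)) / (q + 1)`, with `1 / ∞ = 0`. -/
def IsPValue (q : ℕ) (l : ℝ) (p : ENNReal) : Prop :=
  (|l| ≤ 2 * √(q : ℝ) / (q + 1) ∧ p = 2) ∨
  (2 * √(q : ℝ) / (q + 1) < |l| ∧ 2 < p ∧
    |l| = ((q : ℝ) ^ (p⁻¹).toReal + (q : ℝ) ^ (1 - (p⁻¹).toReal)) / (q + 1))

/-- The number of eigenvalues (with multiplicity) of a `(q + 1)`-regular graph whose `p`-value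
is at least `p`. -/
def pValueCount {q : ℕ} (X : FiniteRegularGraph (q + 1)) (p : ENNReal) : ℕ :=
  Nat.card {i : X.V // ∃ r : ENNReal, IsPValue q (X.eigenvalue i) r ∧ p ≤ r}

/-- The Sarnak–Xue density property with parameter `A` of a family of finite `(q + 1)`-regular
graphs: the implied constant depends only on `ε` (and on the family), not on `p` or the graph. -/
def SarnakXueDensity {q : ℕ} (F : Set (FiniteRegularGraph (q + 1))) (A : ℝ) : Prop :=
  ∀ ε : ℝ, 0 < ε → ∃ C : ℝ, ∀ X ∈ F, ∀ p : ENNReal, 2 < p →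
    (pValueCount X p : ℝ) ≤ C * (X.order : ℝ) ^ (1 - A * (1 - 2 * (p⁻¹).toReal) + ε)

/-- The Cayley graph of a finite group `G` with respect to a finite symmetric subset `S` with `d`
elements: the vertices are the elements of `G`, and `x` is joined to `x * s` for each `s ∈ S`. -/
def cayleyGraph {G : Type} [Group G] [Finite G] {d : ℕ} (S : Finset G)
    (hS : ∀ s ∈ S, s⁻¹ ∈ S) (hd : S.card = d) : FiniteRegularGraph d :=
  letI : Fintype G := Fintype.ofFinite G
  letI : DecidableEq G := Classical.decEq G
  { V := G
    mult := fun x y => if x⁻¹ * y ∈ S then 1 else 0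
    mult_symm := by
      intro x y
      have h : ∀ a b : G, a⁻¹ * b ∈ S → b⁻¹ * a ∈ S := by
        intro a b hab
        simpa using hS _ hab
      simp only [show x⁻¹ * y ∈ S ↔ y⁻¹ * x ∈ S from ⟨h x y, h y x⟩]
    degree_eq := by
      intro x
      rw [← hd, Finset.sum_boole, Nat.cast_id]
      refine Finset.card_bij' (fun y _ => x⁻¹ * y) (fun s _ => x * s) ?_ ?_ ?_ ?_ <;> simp }

/-! ### The Davidoff–Sarnak–Valette graphs -/

/-- The distinguished integer Hamilton quaternions of norm `q`, for an odd prime `q`.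
The coordinates of a quaternion of odd norm `q` are of one parity except for exactly one of them
(for `q ≡ 1 mod 4` the odd one, for `q ≡ 3 mod 4` the even one); it is required that this
exceptional coordinate is the real part and that it is nonnegative. (When the real part is `0`,
both `α` and `-α` occur; they have the same image in `PGL₂`.) -/
def distinguishedQuaternions (q : ℕ) : Set ℍ[ℤ] :=
  {α | Quaternion.normSq α = (q : ℤ) ∧ 0 ≤ α.re ∧
    (α.imI : ZMod 2) = α.imJ ∧ (α.imJ : ZMod 2) = α.imK ∧ (α.re : ZMod 2) ≠ α.imI}

/-- Reduction modulo `t` followed by the isomorphism of the Hamilton quaternions over `ZMod t`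
with the `2 × 2` matrices that is attached to a solution of `x ^ 2 + y ^ 2 + 1 = 0`. -/
def quaternionMatrix {t : ℕ} (x y : ZMod t) (α : ℍ[ℤ]) : Matrix (Fin 2) (Fin 2) (ZMod t) :=
  !![(α.re : ZMod t) + α.imI * x + α.imK * y, -(α.imI : ZMod t) * y + α.imJ + α.imK * x;
     -(α.imI : ZMod t) * y - α.imJ + α.imK * x, (α.re : ZMod t) - α.imI * x - α.imK * y]

/-- The generators of `X^{q,t}`, as elements of `PGL₂(ZMod t)`. -/
def dsvGenerators (q t : ℕ) (x y : ZMod t) : Set PGL(2, ZMod t) :=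
  {g | ∃ α ∈ distinguishedQuaternions q, ∃ M : GL (Fin 2) (ZMod t),
    (M : Matrix (Fin 2) (Fin 2) (ZMod t)) = quaternionMatrix x y α ∧
      g = Matrix.ProjGenLinGroup.mk M}

open Classical in
/-- The group of vertices of `X^{q,t}`: it is `PSL₂(ZMod t)`, seen as a subgroup of
`PGL₂(ZMod t)`, if `q` is a square modulo `t`, and `PGL₂(ZMod t)` otherwise. -/
def dsvGroup (q t : ℕ) : Subgroup PGL(2, ZMod t) :=
  if IsSquare (q : ZMod t) then
    (Matrix.ProjectiveSpecialLinearGroup.toPGL (n := Fin 2) (R := ZMod t)).range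
  else ⊤

instance finiteDsvGroup (q t : ℕ) [NeZero t] : Finite (dsvGroup q t) :=
  haveI : Finite PGL(2, ZMod t) :=
    Finite.of_surjective _ (Matrix.ProjGenLinGroup.mk_surjective (n := Fin 2) (R := ZMod t))
  inferInstance

/-- The family of all `(q' + 1)`-regular Cayley graphs of the groups of the graphs `X^{q,t}`
(`t` an odd prime different from `q`) with respect to a symmetric set of `q' + 1` of the generators
of `X^{q,t}`. -/
def dsvSubsetFamily (q q' : ℕ) : Set (FiniteRegularGraph (q' + 1)) :=
  {X | ∃ (t : ℕ) (_ : NeZero t) (x y : ZMod t) (S : Finset (dsvGroup q t))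
      (hS : ∀ s ∈ S, s⁻¹ ∈ S) (hd : S.card = q' + 1),
    t.Prime ∧ 2 < t ∧ t ≠ q ∧ x ^ 2 + y ^ 2 + 1 = 0 ∧
    (∀ s ∈ S, (s : PGL(2, ZMod t)) ∈ dsvGenerators q t x y) ∧
    X = cayleyGraph S hS hd}

end

/-! # The density property of symmetric subsets of the Davidoff–Sarnak–Valette generators

Let `X = Cay(G, S)` be a graph of the family, `n` its order, `A` its (unnormalized) adjacency
operator and `h k` the solution of `h 0 = 1`, `h 1 = A`, `h (k + 2) = A h (k + 1) - q' h k`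
(`heckeSeq`). An eigenvalue of `p`-value `r` is, up to sign, `x + q' / x` with
`x = q' ^ (1 - 1 / r)`, and there `|h k| ≥ x ^ k` (`pow_le_abs_heckeSeq`). Hence the number of
eigenvalues of `p`-value at least `p` is at most `q' ^ (-2 k (1 - 1 / p)) tr (h k)²`
(`pValueCount_mul_pow_le`). By `h (k + 1)² = h (2 k + 2) + q' h k²` the right side is controlled by
the traces of the `h (2 j)` with `j ≤ k` (`sum_heckeSeq_sq_le`), and `tr h (2 j)` is `n` times the
number of reduced words of length `2 j`, `2 j - 2`, …, `0` in `S` with product `1`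
(`sum_heckeSeq_cayleyGraph`).

A generator lifts to a quaternion of norm `q`. Modulo `q` such a quaternion is a singular `2 × 2`
matrix, that is, of rank one; so the product of a reduced word does not vanish modulo `q`, and its
image determines the first letter. Therefore different reduced words have different quaternion
products, and the closed reduced words of length `2 i` are at most as many as the quaternions of
norm `q ^ (2 i)` that are scalar modulo `t` (`sphereCount_one_le_card`). As long as `q ^ i ≤ t²`
there are `O(t ^ δ (q ^ i / t + 1))` of these (`exists_card_scalar_quaternions_le`): the real part
is `± q ^ i` modulo `t²`, one imaginary part is chosen freely, and the number of representations
of an integer as a sum of two squares is bounded by the number of its divisors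
(`GaussianInt.ncard_norm_eq_le`).

Since `q ≤ q'²`, everything applies to the `k` with `q' ^ k ≤ t < q' ^ (k + 1)`, and then
`tr (h k)²` is `O(n t ^ (1 + δ))`. So the number of eigenvalues in question is
`O(n t ^ (δ - (1 - 2 / p)))`, and `n ≤ t³` gives the exponent `1 / 3`. -/

open scoped MatrixGroups Quaternion

noncomputable section

/-! ### The Hecke recursion and the spectrum -/

/-- The solution of `h 0 = 1`, `h 1 = a`, `h (k + 2) = a * h (k + 1) - c * h k`. If `a` is the
adjacency operator of the `(c + 1)`-regular tree, `h k` is the sum of the operators of summation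
over the spheres of radii `k, k - 2, k - 4, …`. -/
def heckeSeq {R : Type*} [Ring R] (c : ℕ) (a : R) : ℕ → R
  | 0 => 1
  | 1 => a
  | k + 2 => a * heckeSeq c a (k + 1) - c * heckeSeq c a k

theorem map_heckeSeq {R R' : Type*} [Ring R] [Ring R'] (φ : R →+* R') (c : ℕ) (a : R) (k : ℕ) :
    φ (heckeSeq c a k) = heckeSeq c (φ a) k := by
  induction k using Nat.twoStepInduction with
  | zero => simp [heckeSeq]
  | one => simp [heckeSeq]
  | more k h1 h2 => simp [heckeSeq, h1, h2]

theorem heckeSeq_add {R : Type*} [CommRing R] (c : ℕ) (a : R) (m n : ℕ) :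
    heckeSeq c a (m + 1 + (n + 1)) =
      heckeSeq c a (m + 1) * heckeSeq c a (n + 1) - c * (heckeSeq c a m * heckeSeq c a n) := by
  induction n using Nat.twoStepInduction with
  | zero => simp [heckeSeq]; ring
  | one =>
    show heckeSeq c a (m + 1 + 2) = _
    simp only [heckeSeq]; ring
  | more n h1 h2 =>
    have h : heckeSeq c a (m + 1 + (n + 2 + 1)) =
        a * heckeSeq c a (m + 1 + (n + 1 + 1)) - c * heckeSeq c a (m + 1 + (n + 1)) := rfl
    rw [h, h1, h2]
    have e1 : heckeSeq c a (n + 2 + 1) = a * heckeSeq c a (n + 1 + 1) - c * heckeSeq c a (n + 1) :=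
      rfl
    have e2 : heckeSeq c a (n + 2) = a * heckeSeq c a (n + 1) - c * heckeSeq c a n := rfl
    rw [e1, e2]
    ring

theorem heckeSeq_succ_sq {R : Type*} [CommRing R] (c : ℕ) (a : R) (m : ℕ) :
    heckeSeq c a (m + 1) ^ 2 = heckeSeq c a (2 * (m + 1)) + c * heckeSeq c a m ^ 2 := by
  rw [two_mul, heckeSeq_add]
  ring

theorem heckeSeq_neg {R : Type*} [CommRing R] (c : ℕ) (a : R) (k : ℕ) :
    heckeSeq c (-a) k = (-1) ^ k * heckeSeq c a k := by
  induction k using Nat.twoStepInduction with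
  | zero => simp [heckeSeq]
  | one => simp [heckeSeq]
  | more k h1 h2 => simp only [heckeSeq, h1, h2]; ring

theorem heckeSeq_add_succ {R : Type*} [CommRing R] {c : ℕ} {x y : R} (h : x * y = c) (k : ℕ) :
    heckeSeq c (x + y) (k + 1) = x ^ (k + 1) + y * heckeSeq c (x + y) k := by
  induction k with
  | zero => simp [heckeSeq]
  | succ k ih =>
    have e : heckeSeq c (x + y) (k + 1 + 1) =
      (x + y) * heckeSeq c (x + y) (k + 1) - c * heckeSeq c (x + y) k := rfl
    rw [e, ih, ← h]
    ring

theorem pow_le_heckeSeq {c : ℕ} {x y : ℝ} (hx : 0 ≤ x) (hy : 0 ≤ y) (h : x * y = c) (k : ℕ) :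
    x ^ k ≤ heckeSeq c (x + y) k := by
  induction k with
  | zero => simp [heckeSeq]
  | succ k ih =>
    rw [heckeSeq_add_succ h]
    have : 0 ≤ heckeSeq c (x + y) k := (pow_nonneg hx k).trans ih
    nlinarith [mul_nonneg hy this]

theorem pow_le_abs_heckeSeq {c : ℕ} {x y l : ℝ} (hx : 0 ≤ x) (hy : 0 ≤ y) (h : x * y = c)
    (hl : |l| = x + y) (k : ℕ) : x ^ k ≤ |heckeSeq c l k| := by
  have key := (pow_le_heckeSeq hx hy h k).trans (le_abs_self _)
  rcases abs_choice l with h' | h'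
  · rwa [← h', hl]
  · have : l = -(x + y) := by linarith
    rwa [this, heckeSeq_neg, abs_mul, abs_pow, abs_neg, abs_one, one_pow, one_mul]

theorem FiniteRegularGraph.sum_heckeSeq_eigenvalue {d : ℕ} (X : FiniteRegularGraph d) (c k : ℕ) :
    ∑ i, heckeSeq c (d * X.eigenvalue i) k =
      (heckeSeq c ((d : ℝ) • X.adjOp) k).trace := by
  have h := X.adjOp_isHermitian.spectral_theorem
  set U := X.adjOp_isHermitian.eigenvectorUnitary
  set φ := Unitary.conjStarAlgAut ℝ (Matrix X.V X.V ℝ) U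
  have h1 : (d : ℝ) • X.adjOp =
      φ (Matrix.diagonalRingHom X.V ℝ (fun i => d * X.eigenvalue i)) := by
    conv_lhs => rw [h]
    rw [← map_smul]
    congr 1
    ext i j
    by_cases hij : i = j <;> simp [hij, Matrix.diagonal, FiniteRegularGraph.eigenvalue]
  have h2 : heckeSeq c ((d : ℝ) • X.adjOp) k =
      φ (Matrix.diagonalRingHom X.V ℝ (heckeSeq c (fun i => d * X.eigenvalue i) k)) := by
    rw [h1]
    exact ((congrArg φ (map_heckeSeq _ c _ k)).trans
      (map_heckeSeq (φ : Matrix X.V X.V ℝ →+* Matrix X.V X.V ℝ) c _ k)).symm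
  rw [h2, Unitary.conjStarAlgAut_apply, Matrix.trace_mul_cycle]
  simp only [one_mul, Unitary.star_mul_self_of_mem, SetLike.coe_mem]
  simp only [Matrix.diagonalRingHom_apply, Matrix.trace_diagonal]
  refine Finset.sum_congr rfl fun i _ => ?_
  exact (map_heckeSeq (Pi.evalRingHom (fun _ => ℝ) i) c
    (fun i => d * X.eigenvalue i) k).symm

/-! ### Reduced words in a symmetric subset of a group -/

section ReducedWords

variable {G : Type} [Group G] [DecidableEq G]

/-- The number of words `s₀ s₁ … sₘ` of length `m + 1` in the elements of `S` whose first letter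
is `s₀ = s`, whose product is `g`, and which are reduced: `sᵢ₊₁ ≠ sᵢ⁻¹` for all `i`. -/
def reducedCount (S : Finset G) : ℕ → G → G → ℕ
  | 0, s, g => if s = g then 1 else 0
  | m + 1, s, g => ∑ s' ∈ S with s' ≠ s⁻¹, reducedCount S m s' (s⁻¹ * g)

/-- The number of reduced words of length `m` in the elements of `S` with product `g`. -/
def sphereCount (S : Finset G) : ℕ → G → ℕ
  | 0, g => if g = 1 then 1 else 0
  | m + 1, g => ∑ s ∈ S, reducedCount S m s g

/-- The number of reduced words of length `k`, `k - 2`, `k - 4`, … with product `g`. -/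
def sphereCountSum (S : Finset G) : ℕ → G → ℕ
  | 0, g => sphereCount S 0 g
  | 1, g => sphereCount S 1 g
  | k + 2, g => sphereCount S (k + 2) g + sphereCountSum S k g

theorem sphereCountSum_two_mul (S : Finset G) (j : ℕ) (g : G) :
    sphereCountSum S (2 * j) g = ∑ i ∈ Finset.range (j + 1), sphereCount S (2 * i) g := by
  induction j with
  | zero => simp [sphereCountSum]
  | succ j ih =>
    rw [Finset.sum_range_succ, ← ih, add_comm (sphereCountSum S (2 * j) g)]
    rfl

variable {S : Finset G}

/-- The reduced words that can follow the letter `s` are all except those which start with `s⁻¹`. -/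
theorem sum_reducedCount (hS : ∀ s ∈ S, s⁻¹ ∈ S) {s : G} (hs : s ∈ S) (m : ℕ) (g : G) :
    ∑ s' ∈ S, reducedCount S m s' (s⁻¹ * g) =
      reducedCount S (m + 1) s g + reducedCount S m s⁻¹ (s⁻¹ * g) := by
  rw [reducedCount, ← Finset.sum_filter_add_sum_filter_not S (· ≠ s⁻¹)]
  congr 1
  simp [Finset.filter_eq', hS s hs]

theorem reducedCount_inv_add (hS : ∀ s ∈ S, s⁻¹ ∈ S) {s : G} (hs : s ∈ S) (m : ℕ) (g : G) :
    reducedCount S (m + 1) s⁻¹ (s⁻¹ * g) + reducedCount S m s g = sphereCount S (m + 1) g := by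
  have := sum_reducedCount hS (hS s hs) m (s⁻¹ * g)
  simpa [sphereCount] using this.symm

theorem sum_sphereCount_zero (g : G) :
    ∑ s ∈ S, sphereCount S 0 (s⁻¹ * g) = sphereCount S 1 g := by
  simp only [sphereCount, reducedCount, inv_mul_eq_one]

theorem sum_sphereCount_one (hS : ∀ s ∈ S, s⁻¹ ∈ S) (g : G) :
    ∑ s ∈ S, sphereCount S 1 (s⁻¹ * g) = sphereCount S 2 g + S.card * sphereCount S 0 g := by
  have h : ∀ s ∈ S, sphereCount S 1 (s⁻¹ * g) = reducedCount S 1 s g + sphereCount S 0 g := by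
    intro s hs
    refine (sum_reducedCount hS hs 0 g).trans ?_
    simp [sphereCount, reducedCount, eq_comm]
  rw [Finset.sum_congr rfl h, Finset.sum_add_distrib]
  simp [sphereCount]

theorem sum_sphereCount_add_two (hS : ∀ s ∈ S, s⁻¹ ∈ S) (m : ℕ) (g : G) :
    ∑ s ∈ S, sphereCount S (m + 2) (s⁻¹ * g) + sphereCount S (m + 1) g =
      sphereCount S (m + 3) g + S.card * sphereCount S (m + 1) g := by
  have h : ∀ s ∈ S, sphereCount S (m + 2) (s⁻¹ * g) =
      reducedCount S (m + 2) s g + reducedCount S (m + 1) s⁻¹ (s⁻¹ * g) := by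
    intro s hs
    rw [sphereCount, sum_reducedCount hS hs]
  have h' : ∑ s ∈ S, reducedCount S (m + 1) s⁻¹ (s⁻¹ * g) + sphereCount S (m + 1) g =
      S.card * sphereCount S (m + 1) g := by
    rw [sphereCount.eq_2, ← Finset.sum_add_distrib, ← sphereCount.eq_2,
      Finset.sum_congr rfl fun s hs => reducedCount_inv_add hS hs m g]
    simp
  rw [Finset.sum_congr rfl h, Finset.sum_add_distrib, add_assoc, h']
  rfl

/-- `sphereCountSum S` satisfies the recursion of `heckeSeq`, the adjacency operator acting by
summation over the left translates by `S`. -/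
theorem sum_sphereCountSum (hS : ∀ s ∈ S, s⁻¹ ∈ S) {c : ℕ} (hc : S.card = c + 1) (k : ℕ) (g : G) :
    ∑ s ∈ S, sphereCountSum S (k + 1) (s⁻¹ * g) =
      sphereCountSum S (k + 2) g + c * sphereCountSum S k g := by
  induction k using Nat.twoStepInduction with
  | zero =>
    simp only [sphereCountSum, zero_add]
    rw [sum_sphereCount_one hS, hc]
    ring
  | one =>
    have h := sum_sphereCount_add_two hS 0 g
    simp only [sphereCountSum, Finset.sum_add_distrib]
    rw [sum_sphereCount_zero]
    simp only [zero_add, hc, Nat.reduceAdd] at h ⊢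
    linarith
  | more k h1 _ =>
    have h := sum_sphereCount_add_two hS (k + 1) g
    rw [hc] at h
    have e : ∀ j g, sphereCountSum S (j + 2) g = sphereCount S (j + 2) g + sphereCountSum S j g :=
      fun _ _ => rfl
    rw [e (k + 2), e k]
    simp only [show ∀ g, sphereCountSum S (k + 2 + 1) g =
      sphereCount S (k + 1 + 2) g + sphereCountSum S (k + 1) g from fun _ => rfl,
      Finset.sum_add_distrib]
    rw [h1, e k]
    have e3 : k + 1 + 3 = k + 2 + 2 := rfl
    have e2 : k + 1 + 1 = k + 2 := rfl
    rw [e3, e2] at h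
    linarith

theorem heckeSeq_cayley (hS : ∀ s ∈ S, s⁻¹ ∈ S) [Fintype G] {c : ℕ} (hc : S.card = c + 1) (k : ℕ) :
    heckeSeq c (Matrix.of fun x y : G => if x⁻¹ * y ∈ S then (1 : ℝ) else 0) k =
      Matrix.of fun x y : G => (sphereCountSum S k (x⁻¹ * y) : ℝ) := by
  have step : ∀ (F : G → ℕ), (Matrix.of fun x y : G => if x⁻¹ * y ∈ S then (1 : ℝ) else 0) *
      (Matrix.of fun x y : G => (F (x⁻¹ * y) : ℝ)) =
      Matrix.of fun x y : G => ((∑ s ∈ S, F (s⁻¹ * (x⁻¹ * y)) : ℕ) : ℝ) := by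
    intro F
    ext x y
    simp only [Matrix.mul_apply, Matrix.of_apply, ite_mul, one_mul, zero_mul, Nat.cast_sum]
    rw [← Finset.sum_filter]
    refine Finset.sum_bij' (fun z _ => x⁻¹ * z) (fun s _ => x * s) ?_ ?_ ?_ ?_ ?_ <;>
      simp [mul_assoc]
  induction k using Nat.twoStepInduction with
  | zero =>
    ext x y
    by_cases h : x = y <;>
      simp [heckeSeq, sphereCountSum, sphereCount, Matrix.one_apply, inv_mul_eq_one, h]
  | one =>
    ext x y
    simp [heckeSeq, sphereCountSum, sphereCount, reducedCount]
  | more k h1 h2 =>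
    rw [heckeSeq, h2, h1, step]
    ext x y
    simp only [Matrix.sub_apply, Matrix.of_apply, sum_sphereCountSum hS hc]
    have : ((c : Matrix G G ℝ) * Matrix.of fun x y : G => (sphereCountSum S k (x⁻¹ * y) : ℝ)) x y
        = c * (sphereCountSum S k (x⁻¹ * y) : ℝ) := by
      rw [← nsmul_eq_mul]
      simp
    rw [this]
    push_cast
    ring

end ReducedWords

/-- The trace of `heckeSeq` of the adjacency operator counts the reduced words with product `1`. -/
theorem sum_heckeSeq_cayleyGraph {G : Type} [Group G] [Finite G] [DecidableEq G] {c : ℕ}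
    {S : Finset G} (hS : ∀ s ∈ S, s⁻¹ ∈ S) (hd : S.card = c + 1) (k : ℕ) :
    ∑ i, heckeSeq c (((c + 1 : ℕ) : ℝ) * (cayleyGraph S hS hd).eigenvalue i) k =
      Nat.card G * sphereCountSum S k 1 := by
  obtain rfl : ‹DecidableEq G› = Classical.decEq G := Subsingleton.elim _ _
  let : DecidableEq G := Classical.decEq G
  let : Fintype G := Fintype.ofFinite G
  have h : (((c + 1 : ℕ) : ℝ) • (cayleyGraph S hS hd).adjOp : Matrix G G ℝ) =
      Matrix.of fun x y : G => if x⁻¹ * y ∈ S then (1 : ℝ) else 0 := by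
    have h0 : ((c + 1 : ℕ) : ℝ) ≠ 0 := by positivity
    have key : ∀ x y : G, ((c + 1 : ℕ) : ℝ) * (((if x⁻¹ * y ∈ S then 1 else 0 : ℕ) : ℝ) /
        ((c + 1 : ℕ) : ℝ)) = if x⁻¹ * y ∈ S then (1 : ℝ) else 0 := by
      intro x y
      rw [mul_div_cancel₀ _ h0]
      simp
    ext x y
    exact key x y
  rw [FiniteRegularGraph.sum_heckeSeq_eigenvalue]
  have h2 := congrArg Matrix.trace (heckeSeq_cayley hS hd k)
  rw [← h] at h2
  refine Eq.trans h2 ?_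
  simp [Matrix.trace]

/-! ### The matrix representation of the quaternions -/

theorem quaternionMatrix_mul {t : ℕ} {x y : ZMod t} (hxy : x ^ 2 + y ^ 2 + 1 = 0) (α β : ℍ[ℤ]) :
    quaternionMatrix x y (α * β) = quaternionMatrix x y α * quaternionMatrix x y β := by
  have hx : x ^ 2 = -y ^ 2 - 1 := by linear_combination hxy
  ext i j
  fin_cases i <;> fin_cases j <;>
    simp [quaternionMatrix, Matrix.mul_apply, Fin.sum_univ_two] <;> ring_nf <;> simp only [hx] <;>
    ring

theorem quaternionMatrix_coe {t : ℕ} (x y : ZMod t) (c : ℤ) :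
    quaternionMatrix x y (Quaternion.coe c) = (c : ZMod t) • 1 := by
  ext i j
  fin_cases i <;> fin_cases j <;> simp [quaternionMatrix]

theorem quaternionMatrix_one {t : ℕ} (x y : ZMod t) : quaternionMatrix x y 1 = 1 := by
  simpa using quaternionMatrix_coe x y 1

theorem quaternionMatrix_neg {t : ℕ} (x y : ZMod t) (α : ℍ[ℤ]) :
    quaternionMatrix x y (-α) = -quaternionMatrix x y α := by
  ext i j
  fin_cases i <;> fin_cases j <;> simp [quaternionMatrix] <;> ring

theorem det_quaternionMatrix {t : ℕ} {x y : ZMod t} (hxy : x ^ 2 + y ^ 2 + 1 = 0) (α : ℍ[ℤ]) :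
    (quaternionMatrix x y α).det = (Quaternion.normSq α : ℤ) := by
  have hx : x ^ 2 = -y ^ 2 - 1 := by linear_combination hxy
  simp only [quaternionMatrix, Matrix.det_fin_two_of, Quaternion.normSq_def']
  push_cast
  ring_nf
  simp only [hx]
  ring

/-- A quaternion whose matrix is scalar has a scalar reduction. -/
theorem im_eq_zero_of_quaternionMatrix_eq_smul_one {t : ℕ} [Fact t.Prime] (ht : 2 < t)
    {x y : ZMod t} (hxy : x ^ 2 + y ^ 2 + 1 = 0) {α : ℍ[ℤ]} {c : ZMod t}
    (h : quaternionMatrix x y α = c • 1) :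
    (α.re : ZMod t) = c ∧ (α.imI : ZMod t) = 0 ∧ (α.imJ : ZMod t) = 0 ∧ (α.imK : ZMod t) = 0 := by
  have h00 := congrFun (congrFun h 0) 0
  have h01 := congrFun (congrFun h 0) 1
  have h10 := congrFun (congrFun h 1) 0
  have h11 := congrFun (congrFun h 1) 1
  simp [quaternionMatrix] at h00 h01 h10 h11
  have h2 : (2 : ZMod t) ≠ 0 := by
    intro h
    have := (ZMod.natCast_eq_zero_iff 2 t).mp (by exact_mod_cast h)
    exact absurd (Nat.le_of_dvd two_pos this) (by omega)
  refine ⟨mul_left_cancel₀ h2 ?_, mul_left_cancel₀ h2 ?_, mul_left_cancel₀ h2 ?_,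
    mul_left_cancel₀ h2 ?_⟩
  · linear_combination h00 + h11
  · linear_combination (-x) * (h00 - h11) + y * (h01 + h10) + 2 * (α.imI : ZMod t) * hxy
  · linear_combination h01 - h10
  · linear_combination (-y) * (h00 - h11) - x * (h01 + h10) + 2 * (α.imK : ZMod t) * hxy

/-- A singular `2 × 2` matrix has rank at most one, so that it can be cancelled in products. -/
theorem Matrix.mul_eq_zero_or_of_det_eq_zero {F : Type*} [Field F]
    {A B C : Matrix (Fin 2) (Fin 2) F} (hB : B.det = 0) (h : A * B * C = 0) :
    A * B = 0 ∨ B * C = 0 := by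
  -- for `B = u vᵀ` both sides are `(A u)ᵢ vⱼ uₖ (vᵀ C)ₗ`
  have key : ∀ i j k l, (A * B) i j * (B * C) k l = (A * B * C) i l * B k j := by
    rw [Matrix.det_fin_two] at hB
    intro i j k l
    simp only [Matrix.mul_apply, Fin.sum_univ_two]
    fin_cases j <;> fin_cases k <;> simp only [Fin.zero_eta, Fin.mk_one, Fin.isValue]
    · linear_combination (-A i 1 * C 1 l) * hB
    · linear_combination (A i 0 * C 1 l) * hB
    · linear_combination (A i 1 * C 0 l) * hB
    · linear_combination (-A i 0 * C 0 l) * hB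
  by_contra! hne
  obtain ⟨h1, h2⟩ := hne
  obtain ⟨i, j, hij⟩ : ∃ i j, (A * B) i j ≠ 0 := by
    by_contra! h0; exact h1 (Matrix.ext h0)
  obtain ⟨k, l, hkl⟩ : ∃ k l, (B * C) k l ≠ 0 := by
    by_contra! h0; exact h2 (Matrix.ext h0)
  have := key i j k l
  rw [h] at this
  simp [hij, hkl] at this

/-! ### Reduced products of quaternions -/

section ReducedProducts

variable {G : Type} [Group G] [DecidableEq G]

/-- The set of the products `α s₀ * ⋯ * α sₘ` over the reduced words `s₀ … sₘ` in the elements of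
`S` with first letter `s₀ = s`. -/
def reducedProducts (S : Finset G) (α : G → ℍ[ℤ]) : ℕ → G → Finset ℍ[ℤ]
  | 0, s => {α s}
  | m + 1, s =>
    open Classical in ({s' ∈ S | s' ≠ s⁻¹}.biUnion (reducedProducts S α m)).image (α s * ·)

variable {S : Finset G} {α : G → ℍ[ℤ]}

theorem exists_eq_mul_of_mem_reducedProducts {m : ℕ} {s : G} {e : ℍ[ℤ]}
    (he : e ∈ reducedProducts S α m s) : ∃ w, e = α s * w := by
  cases m with
  | zero => exact ⟨1, by simpa [reducedProducts] using he⟩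
  | succ m =>
    simp only [reducedProducts, Finset.mem_image] at he
    obtain ⟨w, -, rfl⟩ := he
    exact ⟨w, rfl⟩

theorem normSq_of_mem_reducedProducts {q : ℤ} (hα : ∀ s ∈ S, Quaternion.normSq (α s) = q) (m : ℕ) :
    ∀ s ∈ S, ∀ e ∈ reducedProducts S α m s, Quaternion.normSq e = q ^ (m + 1) := by
  induction m with
  | zero => simpa [reducedProducts] using hα
  | succ m ih =>
    intro s hs e he
    simp only [reducedProducts, Finset.mem_image, Finset.mem_biUnion, Finset.mem_filter] at he
    obtain ⟨w, ⟨s', ⟨hs', -⟩, hw⟩, rfl⟩ := he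
    rw [map_mul, hα s hs, ih s' hs' w hw]
    ring

section FreeProducts

variable {q : ℕ} [Fact q.Prime] {u v : ZMod q}

/-- Reduced products of quaternions of norm `q` do not vanish modulo `q`. -/
theorem quaternionMatrix_ne_zero_of_mem_reducedProducts (huv : u ^ 2 + v ^ 2 + 1 = 0)
    (hα : ∀ s ∈ S, Quaternion.normSq (α s) = q)
    (h0 : ∀ s ∈ S, quaternionMatrix u v (α s) ≠ 0)
    (hcancel : ∀ s ∈ S, ∀ s' ∈ S, quaternionMatrix u v (α s * α s') = 0 → s' = s⁻¹) (m : ℕ) :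
    ∀ s ∈ S, ∀ e ∈ reducedProducts S α m s, quaternionMatrix u v e ≠ 0 := by
  induction m with
  | zero => simpa [reducedProducts] using h0
  | succ m ih =>
    intro s hs e he hz
    simp only [reducedProducts, Finset.mem_image, Finset.mem_biUnion, Finset.mem_filter] at he
    obtain ⟨w, ⟨s', ⟨hs', hne⟩, hw⟩, rfl⟩ := he
    obtain ⟨w', rfl⟩ := exists_eq_mul_of_mem_reducedProducts hw
    rw [← mul_assoc, quaternionMatrix_mul huv, quaternionMatrix_mul huv] at hz
    have hdet : (quaternionMatrix u v (α s')).det = 0 := by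
      rw [det_quaternionMatrix huv, hα s' hs']; simp
    rcases Matrix.mul_eq_zero_or_of_det_eq_zero hdet hz with h | h
    · rw [← quaternionMatrix_mul huv] at h
      exact hne (hcancel s hs s' hs' h)
    · rw [← quaternionMatrix_mul huv] at h
      exact ih s' hs' _ hw h

/-- The product of a reduced word determines its first letter: modulo `q` the image of the matrix
of the product is the image of the matrix of the first factor. -/
theorem disjoint_reducedProducts (huv : u ^ 2 + v ^ 2 + 1 = 0)
    (hα : ∀ s ∈ S, Quaternion.normSq (α s) = q)
    (h0 : ∀ s ∈ S, quaternionMatrix u v (α s) ≠ 0)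
    (hcancel : ∀ s ∈ S, ∀ s' ∈ S, quaternionMatrix u v (α s * α s') = 0 → s' = s⁻¹)
    (hinj : ∀ s ∈ S, ∀ s' ∈ S, quaternionMatrix u v (star (α s) * α s') = 0 → s = s') (m : ℕ)
    {s s' : G} (hs : s ∈ S) (hs' : s' ∈ S) (hne : s ≠ s') :
    Disjoint (reducedProducts S α m s) (reducedProducts S α m s') := by
  rw [Finset.disjoint_left]
  intro e he he'
  have hne0 := quaternionMatrix_ne_zero_of_mem_reducedProducts huv hα h0 hcancel m s' hs' e he'
  obtain ⟨w, rfl⟩ := exists_eq_mul_of_mem_reducedProducts he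
  obtain ⟨w', hw'⟩ := exists_eq_mul_of_mem_reducedProducts he'
  -- `star (α s) * α s' * w' = star (α s) * α s * w = q * w` vanishes modulo `q`
  have hz : quaternionMatrix u v (star (α s) * α s' * w') = 0 := by
    rw [mul_assoc, ← hw', ← mul_assoc, Quaternion.star_mul_self, hα s hs,
      quaternionMatrix_mul huv, quaternionMatrix_coe]
    simp
  rw [quaternionMatrix_mul huv, quaternionMatrix_mul huv] at hz
  have hdet : (quaternionMatrix u v (α s')).det = 0 := by
    rw [det_quaternionMatrix huv, hα s' hs']; simp
  rcases Matrix.mul_eq_zero_or_of_det_eq_zero hdet hz with h | h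
  · rw [← quaternionMatrix_mul huv] at h
    exact hne (hinj s hs s' hs' h)
  · rw [← quaternionMatrix_mul huv, ← hw'] at h
    exact hne0 h

open Classical in
/-- The number of reduced words with first letter `s` and product `g` is at most the number of
their quaternion products which represent `g`, where `ρ` is a multiplicative relation of representation. -/
theorem reducedCount_le_card (huv : u ^ 2 + v ^ 2 + 1 = 0)
    (hα : ∀ s ∈ S, Quaternion.normSq (α s) = q)
    (h0 : ∀ s ∈ S, quaternionMatrix u v (α s) ≠ 0)
    (hcancel : ∀ s ∈ S, ∀ s' ∈ S, quaternionMatrix u v (α s * α s') = 0 → s' = s⁻¹)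
    (hinj : ∀ s ∈ S, ∀ s' ∈ S, quaternionMatrix u v (star (α s) * α s') = 0 → s = s')
    {ρ : ℍ[ℤ] → G → Prop} (hρ : ∀ s ∈ S, ρ (α s) s)
    (hmul : ∀ a b g h, ρ a g → ρ b h → ρ (a * b) (g * h)) (m : ℕ) :
    ∀ s ∈ S, ∀ g, reducedCount S m s g ≤ {e ∈ reducedProducts S α m s | ρ e g}.card := by
  induction m with
  | zero =>
    intro s hs g
    rw [reducedCount]
    split_ifs with h
    · subst h
      simp [reducedProducts, Finset.filter_singleton, hρ s hs]
    · exact Nat.zero_le _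
  | succ m ih =>
    intro s hs g
    have hq0 : α s ≠ 0 := by
      intro h
      have := hα s hs
      rw [h, map_zero] at this
      exact (Fact.out : q.Prime).ne_zero (by exact_mod_cast this.symm)
    have hd : Set.PairwiseDisjoint ({s' ∈ S | s' ≠ s⁻¹} : Finset G)
        fun s' => {e ∈ reducedProducts S α m s' | ρ e (s⁻¹ * g)} := by
      intro a ha b hb hab
      simp only [Finset.coe_filter, Set.mem_ofPred_eq] at ha hb
      exact Finset.disjoint_filter_filter
        (disjoint_reducedProducts huv hα h0 hcancel hinj m ha.1 hb.1 hab)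
    calc reducedCount S (m + 1) s g
        = ∑ s' ∈ S with s' ≠ s⁻¹, reducedCount S m s' (s⁻¹ * g) := rfl
      _ ≤ ∑ s' ∈ S with s' ≠ s⁻¹, {e ∈ reducedProducts S α m s' | ρ e (s⁻¹ * g)}.card :=
        Finset.sum_le_sum fun s' hs' => ih s' (Finset.mem_filter.mp hs').1 _
      _ = _ := (Finset.card_biUnion hd).symm
      _ ≤ _ := by
        refine Finset.card_le_card_of_injOn (α s * ·) ?_ ?_
        · intro e he
          simp only [Finset.coe_biUnion, Set.mem_iUnion, Finset.coe_filter, Set.mem_ofPred_eq] at he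
          obtain ⟨s', ⟨hs', hne⟩, he, hr⟩ := he
          simp only [Finset.coe_filter, Set.mem_ofPred_eq, reducedProducts, Finset.mem_image,
            Finset.mem_biUnion, Finset.mem_filter]
          refine ⟨⟨e, ⟨s', ⟨hs', hne⟩, he⟩, rfl⟩, ?_⟩
          simpa using hmul _ _ _ _ (hρ s hs) hr
        · intro a _ b _ h
          exact mul_left_cancel₀ hq0 h

theorem sphereCount_le_card (huv : u ^ 2 + v ^ 2 + 1 = 0)
    (hα : ∀ s ∈ S, Quaternion.normSq (α s) = q)
    (h0 : ∀ s ∈ S, quaternionMatrix u v (α s) ≠ 0)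
    (hcancel : ∀ s ∈ S, ∀ s' ∈ S, quaternionMatrix u v (α s * α s') = 0 → s' = s⁻¹)
    (hinj : ∀ s ∈ S, ∀ s' ∈ S, quaternionMatrix u v (star (α s) * α s') = 0 → s = s')
    {ρ : ℍ[ℤ] → G → Prop} (hρ : ∀ s ∈ S, ρ (α s) s)
    (hmul : ∀ a b g h, ρ a g → ρ b h → ρ (a * b) (g * h)) (hone : ρ 1 1) (m : ℕ) (g : G)
    (T : Finset ℍ[ℤ]) (hT : ∀ e, Quaternion.normSq e = (q : ℤ) ^ m → ρ e g → e ∈ T) :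
    sphereCount S m g ≤ T.card := by
  classical
  cases m with
  | zero =>
    rw [sphereCount]
    split_ifs with h
    · subst h
      exact Finset.card_pos.mpr ⟨1, hT 1 (by simp) hone⟩
    · exact Nat.zero_le _
  | succ m =>
    have hd : Set.PairwiseDisjoint (S : Set G)
        fun s => {e ∈ reducedProducts S α m s | ρ e g} := fun a ha b hb hab =>
      Finset.disjoint_filter_filter
        (disjoint_reducedProducts huv hα h0 hcancel hinj m ha hb hab)
    calc sphereCount S (m + 1) g = ∑ s ∈ S, reducedCount S m s g := rfl
      _ ≤ ∑ s ∈ S, {e ∈ reducedProducts S α m s | ρ e g}.card :=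
        Finset.sum_le_sum fun s hs =>
          reducedCount_le_card huv hα h0 hcancel hinj hρ hmul m s hs g
      _ = _ := (Finset.card_biUnion hd).symm
      _ ≤ T.card := by
        refine Finset.card_le_card fun e he => ?_
        simp only [Finset.mem_biUnion, Finset.mem_filter] at he
        obtain ⟨s, hs, he, hr⟩ := he
        exact hT e (normSq_of_mem_reducedProducts hα m s hs e he) hr

end FreeProducts
end ReducedProducts

/-! ### The distinguished quaternions -/

theorem star_mem_distinguishedQuaternions {q : ℕ} {α : ℍ[ℤ]}
    (h : α ∈ distinguishedQuaternions q) : star α ∈ distinguishedQuaternions q := by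
  obtain ⟨h1, h2, h3, h4, h5⟩ := h
  refine ⟨by rw [Quaternion.normSq_star, h1], by simpa using h2, ?_, ?_, ?_⟩ <;>
    simp [CharTwo.neg_eq, h3, h4]
  rw [← h4, ← h3]; exact h5

/-- If `star α * β` is divisible by `q`, then `β = α * w` for a unit `w` of the integer quaternions,
and the parity conditions leave only `w = ± 1`. -/
theorem eq_or_eq_neg_of_mem_distinguishedQuaternions {q : ℕ} [Fact q.Prime] (hq2 : 2 < q)
    {u v : ZMod q} (huv : u ^ 2 + v ^ 2 + 1 = 0) {α β : ℍ[ℤ]}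
    (hα : α ∈ distinguishedQuaternions q) (hβ : β ∈ distinguishedQuaternions q)
    (h : quaternionMatrix u v (star α * β) = 0) : β = α ∨ β = -α := by
  have hq0 : (q : ℤ) ≠ 0 := by exact_mod_cast (Fact.out : q.Prime).ne_zero
  obtain ⟨h0, h1, h2, h3⟩ := im_eq_zero_of_quaternionMatrix_eq_smul_one hq2 huv
    (c := 0) (by rw [h, zero_smul])
  rw [ZMod.intCast_zmod_eq_zero_iff_dvd] at h0 h1 h2 h3
  obtain ⟨a, ha⟩ := h0
  obtain ⟨b, hb⟩ := h1
  obtain ⟨c, hc⟩ := h2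
  obtain ⟨d, hd⟩ := h3
  set w : ℍ[ℤ] := ⟨a, b, c, d⟩ with hw
  have hqw : star α * β = (q : ℤ) • w := by
    ext
    · rw [ha, Quaternion.re_smul]; rfl
    · rw [hb, Quaternion.imI_smul]; rfl
    · rw [hc, Quaternion.imJ_smul]; rfl
    · rw [hd, Quaternion.imK_smul]; rfl
  have hβw : β = α * w := by
    refine smul_right_injective _ hq0 ?_
    show (q : ℤ) • β = (q : ℤ) • (α * w)
    rw [← mul_smul_comm, ← hqw, ← mul_assoc, Quaternion.self_mul_star, hα.1,
      Quaternion.coe_mul_eq_smul]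
  have hN : a ^ 2 + b ^ 2 + c ^ 2 + d ^ 2 = 1 := by
    have e := congrArg Quaternion.normSq hβw
    rw [map_mul, hα.1, hβ.1, Quaternion.normSq_def'] at e
    exact (mul_left_cancel₀ hq0 (by rw [mul_one]; exact e)).symm
  obtain ⟨-, -, p1, p2, p3⟩ := hα
  obtain ⟨-, -, r1, r2, r3⟩ := hβ
  have ha1 : a = 0 ∨ a = 1 ∨ a = -1 := by
    have : a ≤ 1 := by nlinarith [sq_nonneg b, sq_nonneg c, sq_nonneg d]
    have : -1 ≤ a := by nlinarith [sq_nonneg b, sq_nonneg c, sq_nonneg d]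
    omega
  have hrest : a ^ 2 = 1 → b = 0 ∧ c = 0 ∧ d = 0 := by
    intro h
    refine ⟨?_, ?_, ?_⟩ <;> nlinarith [sq_nonneg b, sq_nonneg c, sq_nonneg d]
  rcases ha1 with h | h | h
  · exfalso
    -- right multiplication by `±i`, `±j`, `±k` moves the coordinate of exceptional parity
    have hmod : ((a ^ 2 + b ^ 2 + c ^ 2 + d ^ 2 : ℤ) : ZMod 2) = 1 := by rw [hN]; simp
    -- only one coordinate of the unit `w` is nonzero
    have hprod : ∀ m n k : ℤ, m ^ 2 + n ^ 2 + k ^ 2 = 1 → ((m * n : ℤ) : ZMod 2) = 0 := by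
      intro m n k hmn
      rcases eq_or_ne m 0 with h0 | h0
      · simp [h0]
      rcases eq_or_ne n 0 with h0' | h0'
      · simp [h0']
      have := Int.one_le_abs h0
      have := Int.one_le_abs h0'
      nlinarith [sq_abs m, sq_abs n, sq_nonneg k]
    have hbc := hprod b c d (by rw [h] at hN; linarith)
    have hcd := hprod c d b (by rw [h] at hN; linarith)
    have hbd := hprod b d c (by rw [h] at hN; linarith)
    rw [h] at hmod
    rw [hβw] at r1 r2 r3
    simp only [Quaternion.re_mul, Quaternion.imI_mul, Quaternion.imJ_mul, Quaternion.imK_mul,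
      show w.re = 0 from h, show w.imI = b from rfl, show w.imJ = c from rfl,
      show w.imK = d from rfl] at r1 r2 r3
    push_cast at r1 r2 r3 hmod hbc hcd hbd
    generalize (α.re : ZMod 2) = x0 at *
    generalize (α.imI : ZMod 2) = x1 at *
    generalize (α.imJ : ZMod 2) = x2 at *
    generalize (α.imK : ZMod 2) = x3 at *
    generalize (b : ZMod 2) = b at *
    generalize (c : ZMod 2) = c at *
    generalize (d : ZMod 2) = d at *
    clear * - p1 p2 p3 r1 r2 r3 hmod hbc hcd hbd
    subst p1 p2
    simp only [mul_zero, add_zero, zero_add] at r1 r2 r3 hmod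
    revert x0 x1 b c d
    decide
  · left
    obtain ⟨hb, hc, hd⟩ := hrest (by rw [h]; norm_num)
    rw [hβw]
    have : w = 1 := by ext <;> simp [hw, h, hb, hc, hd]
    rw [this, mul_one]
  · right
    obtain ⟨hb, hc, hd⟩ := hrest (by rw [h]; norm_num)
    rw [hβw]
    have : w = -1 := by ext <;> simp [hw, h, hb, hc, hd]
    rw [this, mul_neg, mul_one]

/-- A quaternion divisible by `q` has norm divisible by `q²`. -/
theorem quaternionMatrix_ne_zero_of_normSq_eq {q : ℕ} [Fact q.Prime] (hq2 : 2 < q)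
    {u v : ZMod q} (huv : u ^ 2 + v ^ 2 + 1 = 0) {α : ℍ[ℤ]} (hα : Quaternion.normSq α = (q : ℤ)) :
    quaternionMatrix u v α ≠ 0 := by
  intro h
  obtain ⟨h0, h1, h2, h3⟩ := im_eq_zero_of_quaternionMatrix_eq_smul_one hq2 huv
    (c := 0) (by rw [h, zero_smul])
  rw [ZMod.intCast_zmod_eq_zero_iff_dvd] at h0 h1 h2 h3
  have hdvd : (q : ℤ) ^ 2 ∣ q := by
    nth_rewrite 2 [← hα]
    rw [Quaternion.normSq_def']
    exact dvd_add (dvd_add (dvd_add (pow_dvd_pow_of_dvd h0 2) (pow_dvd_pow_of_dvd h1 2))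
      (pow_dvd_pow_of_dvd h2 2)) (pow_dvd_pow_of_dvd h3 2)
  have := Int.le_of_dvd (by positivity) hdvd
  have h2q : (2 : ℤ) < q := by exact_mod_cast hq2
  nlinarith

/-- The quaternion `e` represents the element `g` of `PGL₂(ZMod t)`. -/
def Represents {t : ℕ} (x y : ZMod t) (e : ℍ[ℤ]) (g : PGL(2, ZMod t)) : Prop :=
  ∃ M : GL (Fin 2) (ZMod t), (M : Matrix (Fin 2) (Fin 2) (ZMod t)) = quaternionMatrix x y e ∧
    g = Matrix.ProjGenLinGroup.mk M

namespace Represents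

variable {t : ℕ} {x y : ZMod t} {a b : ℍ[ℤ]} {g h : PGL(2, ZMod t)}

theorem one : Represents x y 1 1 := ⟨1, by simp [quaternionMatrix_one], by simp⟩

theorem mul (hxy : x ^ 2 + y ^ 2 + 1 = 0) (ha : Represents x y a g) (hb : Represents x y b h) :
    Represents x y (a * b) (g * h) := by
  obtain ⟨M, hM, rfl⟩ := ha
  obtain ⟨N, hN, rfl⟩ := hb
  exact ⟨M * N, by rw [quaternionMatrix_mul hxy, Units.val_mul, hM, hN], by rw [map_mul]⟩

theorem eq_of_eq_smul (ha : Represents x y a g) (hb : Represents x y b h) (c : (ZMod t)ˣ)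
    (hc : quaternionMatrix x y b = (c : ZMod t) • quaternionMatrix x y a) : g = h := by
  obtain ⟨M, hM, rfl⟩ := ha
  obtain ⟨N, hN, rfl⟩ := hb
  rw [Matrix.ProjGenLinGroup.mk_eq_mk_iff]
  refine ⟨c, Units.ext ?_⟩
  rw [hN, hc, ← hM, Units.val_mul]
  ext i j
  simp [mul_comm]

theorem exists_eq_smul_one (ha : Represents x y a 1) :
    ∃ c : ZMod t, quaternionMatrix x y a = c • 1 := by
  obtain ⟨M, hM, h⟩ := ha
  rw [eq_comm, Matrix.ProjGenLinGroup.mk_eq_one,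
    Matrix.GeneralLinearGroup.mem_center_iff_val_mem_range_scalar] at h
  obtain ⟨c, hc⟩ := h
  refine ⟨c, ?_⟩
  rw [← hM, ← hc, Matrix.smul_one_eq_diagonal]
  rfl

end Represents

/-- A closed reduced word of length `m` in generators of the Davidoff–Sarnak–Valette graph gives
a quaternion of norm `q ^ m` that is scalar modulo `t`, and different words give different
quaternions. -/
theorem sphereCount_one_le_card {q t : ℕ} [Fact q.Prime] [Fact t.Prime] (hq2 : 2 < q) (ht2 : 2 < t)
    (htq : t ≠ q) {x y : ZMod t} (hxy : x ^ 2 + y ^ 2 + 1 = 0) [DecidableEq (dsvGroup q t)]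
    {S : Finset (dsvGroup q t)} (hS : ∀ s ∈ S, (s : PGL(2, ZMod t)) ∈ dsvGenerators q t x y)
    (m : ℕ) (T : Finset ℍ[ℤ])
    (hT : ∀ e : ℍ[ℤ], Quaternion.normSq e = (q : ℤ) ^ m → (t : ℤ) ∣ e.imI → (t : ℤ) ∣ e.imJ →
      (t : ℤ) ∣ e.imK → e ∈ T) :
    sphereCount S m 1 ≤ T.card := by
  obtain ⟨u, v, huv⟩ := ZMod.sq_add_sq q (-1)
  replace huv : u ^ 2 + v ^ 2 + 1 = 0 := by rw [huv]; ring
  have hqt : ((q : ℤ) : ZMod t) ≠ 0 := by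
    rw [Int.cast_natCast, Ne, ZMod.natCast_eq_zero_iff]
    intro h
    exact htq ((Nat.prime_dvd_prime_iff_eq Fact.out Fact.out).mp h)
  have hex : ∀ s ∈ S, ∃ α ∈ distinguishedQuaternions q, Represents x y α s := by
    intro s hs
    obtain ⟨α, hα, M, hM, h⟩ := hS s hs
    exact ⟨α, hα, M, hM, h⟩
  choose! α hα hρ using hex
  refine sphereCount_le_card (q := q) (α := α) huv (fun s hs => (hα s hs).1)
    (fun s hs => quaternionMatrix_ne_zero_of_normSq_eq hq2 huv (hα s hs).1) ?_ ?_
    (ρ := fun e g => Represents x y e g) hρ (fun a b g h ha hb => ?_) ?_ m 1 T ?_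
  · intro s hs s' hs' h
    have h' := eq_or_eq_neg_of_mem_distinguishedQuaternions hq2 huv
      (star_mem_distinguishedQuaternions (hα s hs)) (hα s' hs') (by rwa [star_star])
    have hprod := (hρ s hs).mul hxy (hρ s' hs')
    have hnorm : α s * star (α s) = Quaternion.coe (q : ℤ) := by
      rw [Quaternion.self_mul_star, (hα s hs).1]
    have h1 : (1 : PGL(2, ZMod t)) = s * s' := by
      rcases h' with h' | h' <;> rw [h'] at hprod
      · rw [hnorm] at hprod
        refine Represents.one.eq_of_eq_smul hprod (Units.mk0 _ hqt) ?_
        rw [quaternionMatrix_coe, quaternionMatrix_one, Units.val_mk0]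
      · rw [mul_neg, hnorm] at hprod
        refine Represents.one.eq_of_eq_smul hprod (-Units.mk0 _ hqt) ?_
        rw [quaternionMatrix_neg, quaternionMatrix_coe, quaternionMatrix_one, Units.val_neg,
          Units.val_mk0, neg_smul]
    exact eq_inv_of_mul_eq_one_right (Subtype.ext h1.symm)
  · intro s hs s' hs' h
    have h1 : (s : PGL(2, ZMod t)) = s' := by
      rcases eq_or_eq_neg_of_mem_distinguishedQuaternions hq2 huv (hα s hs) (hα s' hs') h
        with h' | h'
      · exact (hρ s hs).eq_of_eq_smul (hρ s' hs') 1 (by rw [h', Units.val_one, one_smul])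
      · exact (hρ s hs).eq_of_eq_smul (hρ s' hs') (-1)
          (by rw [h', Units.val_neg, Units.val_one, neg_one_smul, quaternionMatrix_neg])
    exact Subtype.ext h1
  · exact ha.mul hxy hb
  · exact Represents.one
  · intro e he hr
    obtain ⟨c, hc⟩ := Represents.exists_eq_smul_one hr
    obtain ⟨-, h1, h2, h3⟩ := im_eq_zero_of_quaternionMatrix_eq_smul_one ht2 hxy hc
    rw [ZMod.intCast_zmod_eq_zero_iff_dvd] at h1 h2 h3
    exact hT e he h1 h2 h3

/-! ### The divisor bound -/

theorem exists_card_divisors_le {δ : ℝ} (hδ : 0 < δ) :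
    ∃ K : ℝ, 1 ≤ K ∧ ∀ n : ℕ, n ≠ 0 → (n.divisors.card : ℝ) ≤ K * (n : ℝ) ^ δ := by
  have hlog : 0 < Real.log 2 := Real.log_pos one_lt_two
  set K₀ : ℝ := 1 + 1 / (δ * Real.log 2) with hK₀
  have hK₀1 : 1 ≤ K₀ := by rw [hK₀]; linarith [show 0 < 1 / (δ * Real.log 2) by positivity]
  set B : ℕ := ⌈(2 : ℝ) ^ (1 / δ)⌉₊ with hB
  -- the ratio `(e + 1) / p ^ (e δ)` is at most `K₀` for every prime `p`, because
  -- `2 ^ (e δ) ≥ 1 + e δ log 2`, and at most `1` if `p ≥ B`, because then `p ^ δ ≥ 2`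
  have hsmall : ∀ (p e : ℕ), 2 ≤ p → ((e + 1 : ℕ) : ℝ) ≤ K₀ * ((p : ℝ) ^ e) ^ δ := by
    intro p e hp
    have h1 : (1 : ℝ) + e * (δ * Real.log 2) ≤ ((p : ℝ) ^ e) ^ δ := by
      have h2 : (((2 : ℝ)) ^ e) ^ δ ≤ ((p : ℝ) ^ e) ^ δ := by
        have : (2 : ℝ) ≤ p := by exact_mod_cast hp
        gcongr
      refine le_trans ?_ h2
      rw [← Real.rpow_natCast, ← Real.rpow_mul zero_le_two, Real.rpow_def_of_pos two_pos]
      linarith [Real.add_one_le_exp (Real.log 2 * (e * δ))]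
    have h3 : ((e + 1 : ℕ) : ℝ) ≤ K₀ * (1 + e * (δ * Real.log 2)) := by
      have : K₀ * (1 + e * (δ * Real.log 2)) =
          1 + e + e * (δ * Real.log 2) + 1 / (δ * Real.log 2) := by
        rw [hK₀]; field_simp; ring
      rw [this]
      push_cast
      have : 0 ≤ e * (δ * Real.log 2) := by positivity
      have : 0 ≤ 1 / (δ * Real.log 2) := by positivity
      linarith
    exact h3.trans (mul_le_mul_of_nonneg_left h1 (by linarith))
  have hlarge : ∀ (p e : ℕ), B ≤ p → ((e + 1 : ℕ) : ℝ) ≤ ((p : ℝ) ^ e) ^ δ := by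
    intro p e hp
    have h1 : (2 : ℝ) ^ (1 / δ) ≤ p := (Nat.le_ceil _).trans (by exact_mod_cast hp)
    have h2 : (2 : ℝ) ≤ (p : ℝ) ^ δ := by
      calc (2 : ℝ) = ((2 : ℝ) ^ (1 / δ)) ^ δ := by
            rw [← Real.rpow_mul zero_le_two, one_div_mul_cancel hδ.ne', Real.rpow_one]
        _ ≤ _ := by gcongr
    calc ((e + 1 : ℕ) : ℝ) ≤ (2 : ℝ) ^ e := by exact_mod_cast Nat.lt_two_pow_self
      _ ≤ ((p : ℝ) ^ δ) ^ e := by gcongr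
      _ = ((p : ℝ) ^ e) ^ δ := by
        rw [← Real.rpow_natCast, ← Real.rpow_natCast, ← Real.rpow_mul (by positivity),
          ← Real.rpow_mul (by positivity), mul_comm]
  refine ⟨K₀ ^ B, one_le_pow₀ hK₀1, fun n hn => ?_⟩
  have hcard : ({p ∈ n.primeFactors | p < B} : Finset ℕ).card ≤ B := by
    calc _ ≤ (Finset.range B).card :=
          Finset.card_le_card fun p hp => Finset.mem_range.mpr (Finset.mem_filter.mp hp).2
      _ = B := Finset.card_range B
  have hprod : ∏ p ∈ n.primeFactors, (if p < B then K₀ else 1) ≤ K₀ ^ B := by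
    rw [← Finset.prod_filter, Finset.prod_const]
    exact pow_le_pow_right₀ hK₀1 hcard
  have hn' : ∏ p ∈ n.primeFactors, ((p : ℝ) ^ n.factorization p) ^ δ = (n : ℝ) ^ δ := by
    rw [Real.finsetProd_rpow _ _ (fun p _ => by positivity)]
    congr 1
    have := Nat.prod_factorization_pow_eq_self hn
    rw [Finsupp.prod, Nat.support_factorization] at this
    exact_mod_cast this
  calc (n.divisors.card : ℝ) = ∏ p ∈ n.primeFactors, ((n.factorization p + 1 : ℕ) : ℝ) := by
        rw [Nat.card_divisors hn]; push_cast; rfl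
    _ ≤ ∏ p ∈ n.primeFactors, (if p < B then K₀ else 1) * ((p : ℝ) ^ n.factorization p) ^ δ := by
        refine Finset.prod_le_prod (fun p _ => by positivity) fun p hp => ?_
        split_ifs with h
        · exact hsmall p _ (Nat.prime_of_mem_primeFactors hp).two_le
        · rw [one_mul]; exact hlarge p _ (not_lt.mp h)
    _ ≤ K₀ ^ B * (n : ℝ) ^ δ := by
        rw [Finset.prod_mul_distrib, hn']
        gcongr

/-! ### Sums of two squares -/

theorem GaussianInt.finite_setOf_norm_eq (n : ℤ) : {z : GaussianInt | z.norm = n}.Finite := by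
  refine Set.Finite.subset (Set.Finite.image (fun p : ℤ × ℤ => (⟨p.1, p.2⟩ : GaussianInt))
    ((Set.finite_Icc (-n) n).prod (Set.finite_Icc (-n) n))) ?_
  intro z hz
  have h : z.re * z.re + z.im * z.im = n := by
    have := hz
    simp only [Set.mem_ofPred_eq, Zsqrtd.norm_def] at this
    linarith
  refine ⟨(z.re, z.im), ⟨⟨?_, ?_⟩, ?_, ?_⟩, rfl⟩ <;> simp only <;>
    nlinarith [sq_nonneg z.re, sq_nonneg z.im, Int.le_self_sq z.re, Int.le_self_sq z.im,
      Int.le_self_sq (-z.re), Int.le_self_sq (-z.im)]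

/-- Among `a + 1` Gaussian integers `c 0, …, c a` depending only on `p` and `a` there is, for every
`z` of norm `p ^ a * n` with `p ∤ n`, one whose quotient in `z` has norm `n`. If `p = π * star π`
splits or ramifies, these are the `π ^ b * star π ^ (a - b)`; if `p` is inert, the powers of `p`. -/
theorem GaussianInt.exists_eq_mul_of_norm_eq {p : ℕ} (hp : p.Prime) {n : ℕ} (hpn : ¬p ∣ n) (a : ℕ) :
    ∃ c : ℕ → GaussianInt, ∀ z : GaussianInt, z.norm = (p : ℤ) ^ a * n →
      ∃ b ≤ a, ∃ w : GaussianInt, z = c b * w ∧ w.norm = n := by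
  have : Fact p.Prime := ⟨hp⟩
  have hp0 : (p : ℤ) ≠ 0 := by exact_mod_cast hp.ne_zero
  have hnorm : ∀ z : GaussianInt, (z.norm : GaussianInt) = z * star z := Zsqrtd.norm_eq_mul_conj
  by_cases hirr : Prime (p : GaussianInt)
  · refine ⟨fun b => p ^ b, ?_⟩
    induction a using Nat.twoStepInduction with
    | zero => exact fun z hz => ⟨0, le_rfl, z, by simp, by simpa using hz⟩
    | one =>
      intro z hz
      have hdvd : (p : GaussianInt) ∣ z * star z := by
        rw [← hnorm, hz]
        exact ⟨n, by push_cast; ring⟩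
      have hz' : (p : GaussianInt) ∣ z := by
        rcases hirr.dvd_or_dvd hdvd with h | h
        · exact h
        · obtain ⟨w, hw⟩ := h
          exact ⟨star w, by rw [← star_star z, hw, star_mul', star_natCast]⟩
      obtain ⟨w, rfl⟩ := hz'
      -- the norm of a multiple of an inert `p` is divisible by `p²`
      exfalso
      rw [Zsqrtd.norm_mul, Zsqrtd.norm_natCast, pow_one, mul_assoc] at hz
      have := mul_left_cancel₀ hp0 hz
      exact hpn (by exact_mod_cast Dvd.intro _ this)
    | more a ih _ =>
      intro z hz
      have hdvd : (p : GaussianInt) ∣ z * star z := by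
        rw [← hnorm, hz]
        exact ⟨p ^ (a + 1) * n, by push_cast; ring⟩
      have hz' : (p : GaussianInt) ∣ z := by
        rcases hirr.dvd_or_dvd hdvd with h | h
        · exact h
        · obtain ⟨w, hw⟩ := h
          exact ⟨star w, by rw [← star_star z, hw, star_mul', star_natCast]⟩
      obtain ⟨w, rfl⟩ := hz'
      rw [Zsqrtd.norm_mul, Zsqrtd.norm_natCast] at hz
      have hw : w.norm = (p : ℤ) ^ a * n := by
        refine mul_left_cancel₀ (mul_ne_zero hp0 hp0) ?_
        rw [hz]; ring
      obtain ⟨b, hb, w', rfl, hw'⟩ := ih w hw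
      exact ⟨b + 1, by omega, w', by ring, hw'⟩
  · obtain ⟨u, v, huv⟩ := GaussianInt.sq_add_sq_of_nat_prime_of_not_irreducible p
      (fun h => hirr h.prime)
    set π : GaussianInt := ⟨u, v⟩ with hπ
    have hπn : π.norm = p := by
      rw [← huv, hπ, Zsqrtd.norm_def]; push_cast; ring
    have hπp : (p : GaussianInt) = π * star π := by rw [← hnorm, hπn]; simp
    have hprime : Prime π := by
      refine Irreducible.prime ⟨?_, ?_⟩
      · rw [← Zsqrtd.norm_eq_one_iff, hπn]
        simpa using hp.one_lt.ne'
      · intro x y hxy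
        have h := congrArg (fun z => (Zsqrtd.norm z).natAbs) hxy
        simp only [Zsqrtd.norm_mul, Int.natAbs_mul, hπn, Int.natAbs_natCast] at h
        rcases (Nat.prime_mul_iff.mp (h ▸ hp)) with ⟨-, h⟩ | ⟨-, h⟩
        · exact Or.inr (Zsqrtd.norm_eq_one_iff.mp h)
        · exact Or.inl (Zsqrtd.norm_eq_one_iff.mp h)
    refine ⟨fun b => π ^ b * star π ^ (a - b), ?_⟩
    induction a with
    | zero => exact fun z hz => ⟨0, le_rfl, z, by simp, by simpa using hz⟩
    | succ a ih =>
      intro z hz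
      have hdvd : π ∣ z * star z := by
        rw [← hnorm, hz]
        exact ⟨star π * p ^ a * n, by push_cast; rw [pow_succ, hπp]; ring⟩
      have hquot : ∀ ϖ w : GaussianInt, ϖ.norm = p → z = ϖ * w → w.norm = (p : ℤ) ^ a * n := by
        intro ϖ w hϖ hzw
        refine mul_left_cancel₀ hp0 ?_
        nth_rewrite 1 [← hϖ]
        rw [← Zsqrtd.norm_mul, ← hzw, hz]; ring
      rcases hprime.dvd_or_dvd hdvd with ⟨w, hw⟩ | ⟨w, hw⟩
      · obtain ⟨b, hb, w', rfl, hw'⟩ := ih w (hquot π w hπn hw)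
        refine ⟨b + 1, by omega, w', ?_, hw'⟩
        have e : a + 1 - (b + 1) = a - b := by omega
        simp only [hw, e]; ring
      · have hz' : z = star π * star w := by rw [← star_star z, hw, star_mul']
        obtain ⟨b, hb, w', hw', hn⟩ := ih (star w)
          (hquot (star π) _ (by rw [Zsqrtd.norm_conj, hπn]) hz')
        refine ⟨b, by omega, w', ?_, hn⟩
        have e : a + 1 - b = a - b + 1 := by omega
        simp only [hz', hw', e]; ring

theorem GaussianInt.ncard_norm_eq_le (n : ℕ) (hn : n ≠ 0) :
    {z : GaussianInt | z.norm = n}.ncard ≤ 9 * n.divisors.card := by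
  induction n using Nat.recOnPrimePow with
  | zero => exact absurd rfl hn
  | one =>
    have hsub : {z : GaussianInt | z.norm = (1 : ℕ)} ⊆
        ((Finset.Icc (-1 : ℤ) 1 ×ˢ Finset.Icc (-1 : ℤ) 1).image
          fun p : ℤ × ℤ => (⟨p.1, p.2⟩ : GaussianInt) : Finset GaussianInt) := by
      intro z hz
      have h : z.re * z.re + z.im * z.im = 1 := by
        have := hz
        simp only [Set.mem_ofPred_eq, Zsqrtd.norm_def, Nat.cast_one] at this
        linarith
      simp only [Finset.coe_image, Finset.coe_product, Set.mem_image, Set.mem_prod]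
      refine ⟨(z.re, z.im), ⟨?_, ?_⟩, rfl⟩ <;> simp only [Finset.coe_Icc, Set.mem_Icc] <;>
        constructor <;> nlinarith [sq_nonneg z.re, sq_nonneg z.im]
    refine (Set.ncard_le_ncard hsub (Finset.finite_toSet _)).trans ?_
    rw [Set.ncard_coe_finset]
    exact Finset.card_image_le.trans (by simp)
  | prime_pow_mul n p a hp hpn ha ih =>
    have hn0 : n ≠ 0 := by rintro rfl; simp at hpn
    obtain ⟨c, hc⟩ := GaussianInt.exists_eq_mul_of_norm_eq hp hpn a
    set F : Finset GaussianInt := (GaussianInt.finite_setOf_norm_eq n).toFinset with hF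
    have hFcard : F.card = {z : GaussianInt | z.norm = n}.ncard :=
      (Set.ncard_eq_toFinset_card _ _).symm
    have hsub : {z : GaussianInt | z.norm = (p ^ a * n : ℕ)} ⊆
        ((Finset.range (a + 1)).biUnion fun b => F.image (c b * ·) : Finset GaussianInt) := by
      intro z hz
      obtain ⟨b, hb, w, hw, hwn⟩ := hc z (by simpa using hz)
      simp only [Finset.coe_biUnion, Set.mem_iUnion, Finset.coe_range, Set.mem_Iio,
        Finset.coe_image, Set.mem_image]
      exact ⟨b, by omega, w, by simp [hF, hwn], hw.symm⟩
    have hcop : Nat.Coprime (p ^ a) n := Nat.Coprime.pow_left _ ((hp.coprime_iff_not_dvd).mpr hpn)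
    calc {z : GaussianInt | z.norm = (p ^ a * n : ℕ)}.ncard
        ≤ ((Finset.range (a + 1)).biUnion fun b => F.image (c b * ·)).card := by
          rw [← Set.ncard_coe_finset]
          exact Set.ncard_le_ncard hsub (Finset.finite_toSet _)
      _ ≤ (Finset.range (a + 1)).card * F.card :=
          Finset.card_biUnion_le_card_mul _ _ _ fun b _ => Finset.card_image_le
      _ ≤ (a + 1) * (9 * n.divisors.card) := by
          rw [Finset.card_range, hFcard]
          exact Nat.mul_le_mul_left _ (ih hn0)
      _ = 9 * (p ^ a * n).divisors.card := by
          rw [hcop.card_divisors_mul, Nat.divisors_prime_pow hp]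
          simp; ring

theorem exists_ncard_norm_eq_le {δ : ℝ} (hδ : 0 < δ) :
    ∃ K : ℝ, 1 ≤ K ∧ ∀ (n : ℤ) (B : ℝ), 1 ≤ B → n ≤ B →
      ({z : GaussianInt | z.norm = n}.ncard : ℝ) ≤ K * B ^ δ := by
  obtain ⟨K, hK, h⟩ := exists_card_divisors_le hδ
  refine ⟨9 * K, by linarith, fun n B hB hnB => ?_⟩
  have hBδ : 1 ≤ B ^ δ := Real.one_le_rpow hB hδ.le
  have h1 : (1 : ℝ) ≤ 9 * K * B ^ δ := by nlinarith
  rcases lt_trichotomy n 0 with hn | rfl | hn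
  · have : {z : GaussianInt | z.norm = n} = ∅ := by
      ext z
      simp only [Set.mem_ofPred_eq, Set.mem_empty_iff_false, iff_false]
      have := GaussianInt.norm_nonneg z
      omega
    rw [this, Set.ncard_empty]
    push_cast; linarith
  · have : {z : GaussianInt | z.norm = 0} = {0} := by
      ext z; simp [GaussianInt.norm_eq_zero]
    rw [this, Set.ncard_singleton]
    simpa using h1
  · lift n to ℕ using hn.le
    have hn0 : n ≠ 0 := by rintro rfl; simp at hn
    calc ({z : GaussianInt | z.norm = n}.ncard : ℝ) ≤ ((9 * n.divisors.card : ℕ) : ℝ) := by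
          exact_mod_cast GaussianInt.ncard_norm_eq_le n hn0
      _ ≤ 9 * (K * (n : ℝ) ^ δ) := by
          push_cast
          linarith [h n hn0]
      _ ≤ 9 * (K * B ^ δ) := by
          have : (n : ℝ) ≤ B := by exact_mod_cast hnB
          gcongr
      _ = _ := by ring

/-! ### Quaternions of given norm that are scalar modulo a prime -/

/-- The quaternions of norm `N²` that are scalar modulo `t` are `O(t ^ δ (N / t + 1))` in number
as long as `N ≤ t²`: the real part is congruent to `± N` modulo `t²`, which leaves six values,
and for given real and first imaginary parts a sum of two squares is prescribed. -/
theorem exists_card_scalar_quaternions_le {δ : ℝ} (hδ : 0 < δ) :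
    ∃ K : ℝ, 1 ≤ K ∧ ∀ t N : ℕ, t.Prime → 2 < t → 0 < N → ¬t ∣ N → N ≤ t ^ 2 →
      ∃ T : Finset ℍ[ℤ], (∀ e : ℍ[ℤ], Quaternion.normSq e = (N : ℤ) ^ 2 →
        (t : ℤ) ∣ e.imI → (t : ℤ) ∣ e.imJ → (t : ℤ) ∣ e.imK → e ∈ T) ∧
        (T.card : ℝ) ≤ K * (t : ℝ) ^ δ * (N / t + 1) := by
  obtain ⟨K, hK, h⟩ := exists_ncard_norm_eq_le (δ := δ / 4) (by linarith)
  refine ⟨12 * K, by linarith, fun t N ht ht2 hN htN hNt => ?_⟩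
  have ht0 : (0 : ℤ) < t := by exact_mod_cast ht.pos
  have htp : Prime (t : ℤ) := Nat.prime_iff_prime_int.mp ht
  set A : Finset ℤ := {(N : ℤ), (N : ℤ) - (t : ℤ) ^ 2, (N : ℤ) - 2 * (t : ℤ) ^ 2,
    -(N : ℤ), (t : ℤ) ^ 2 - (N : ℤ), 2 * (t : ℤ) ^ 2 - (N : ℤ)} with hA
  set M : ℤ → ℤ → ℤ := fun a b => ((N : ℤ) ^ 2 - a ^ 2) / t ^ 2 - b ^ 2 with hM
  set I : Finset ℤ := Finset.Icc (-((N / t : ℕ) : ℤ)) ((N / t : ℕ) : ℤ) with hI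
  set F : ℤ → ℤ → Finset GaussianInt := fun a b =>
    (GaussianInt.finite_setOf_norm_eq (M a b)).toFinset with hF
  classical
  refine ⟨A.biUnion fun a => I.biUnion fun b => (F a b).image fun z =>
    (⟨a, t * b, t * z.re, t * z.im⟩ : ℍ[ℤ]), ?_, ?_⟩
  · rintro e he ⟨b, hb⟩ ⟨c, hc⟩ ⟨d, hd⟩
    rw [Quaternion.normSq_def', hb, hc, hd] at he
    set a : ℤ := e.re with ha
    have he' : (N : ℤ) ^ 2 - a ^ 2 = t ^ 2 * (b ^ 2 + c ^ 2 + d ^ 2) := by linarith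
    simp only [Finset.mem_biUnion]
    have hbd : 0 ≤ b ^ 2 + c ^ 2 + d ^ 2 := by positivity
    have haN : |a| ≤ N := by
      refine abs_le_of_sq_le_sq ?_ (by positivity)
      nlinarith [mul_nonneg (sq_nonneg (t : ℤ)) hbd]
    rw [abs_le] at haN
    refine ⟨a, ?_, b, ?_, Finset.mem_image.mpr ⟨⟨c, d⟩, ?_, by ext <;> simp [ha, hb, hc, hd]⟩⟩
    · -- `t` cannot divide both factors of `(N - a) (N + a)`
      have hfac : ((t : ℤ) ^ 2) ∣ (N - a) * (N + a) := ⟨b ^ 2 + c ^ 2 + d ^ 2, by linarith⟩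
      have hnot : ¬((t : ℤ) ∣ N - a ∧ (t : ℤ) ∣ N + a) := by
        rintro ⟨h1, h2⟩
        have h3 : (t : ℤ) ∣ 2 * N := by
          have := dvd_add h1 h2
          rwa [show (N : ℤ) - a + (N + a) = 2 * N by ring] at this
        rcases htp.dvd_or_dvd h3 with h4 | h4
        · exact absurd (Int.le_of_dvd two_pos h4) (by omega)
        · exact htN (by exact_mod_cast h4)
      have hNt' : (N : ℤ) ≤ t ^ 2 := by exact_mod_cast hNt
      have hN' : (0 : ℤ) < N := by exact_mod_cast hN
      have key : ∀ r : ℤ, 0 ≤ r → r ≤ 2 * N → (t : ℤ) ^ 2 ∣ r →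
          r = 0 ∨ r = t ^ 2 ∨ r = 2 * t ^ 2 := by
        rintro r h0 h1 ⟨k, rfl⟩
        have ht2' : (0 : ℤ) < t ^ 2 := by positivity
        have hk0 : 0 ≤ k := nonneg_of_mul_nonneg_right h0 ht2'
        have hk2 : k ≤ 2 := by
          by_contra! hk
          nlinarith
        interval_cases k
        · simp
        · simp
        · right; right; ring
      have hA' : (t : ℤ) ^ 2 ∣ N - a ∨ (t : ℤ) ^ 2 ∣ N + a := by
        rw [not_and_or] at hnot
        rcases hnot with h1 | h1
        · exact Or.inr ((((htp.coprime_iff_not_dvd).mpr h1).pow_left).dvd_of_dvd_mul_left hfac)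
        · exact Or.inl ((((htp.coprime_iff_not_dvd).mpr h1).pow_left).dvd_of_dvd_mul_right hfac)
      simp only [hA, Finset.mem_insert, Finset.mem_singleton]
      rcases hA' with h1 | h1
      · rcases key _ (by linarith) (by linarith) h1 with h2 | h2 | h2
        · left; linarith
        · right; left; linarith
        · right; right; left; linarith
      · rcases key _ (by linarith) (by linarith) h1 with h2 | h2 | h2
        · right; right; right; left; linarith
        · right; right; right; right; left; linarith
        · right; right; right; right; right; linarith
    · have hb : |b| * t ≤ N := by
        rw [← abs_of_pos ht0, ← abs_mul]
        refine abs_le_of_sq_le_sq ?_ (by positivity)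
        nlinarith [sq_nonneg a, mul_nonneg (sq_nonneg (t : ℤ)) (sq_nonneg c),
          mul_nonneg (sq_nonneg (t : ℤ)) (sq_nonneg d)]
      have hb' : |b| ≤ ((N / t : ℕ) : ℤ) := by
        push_cast
        exact (Int.le_ediv_iff_mul_le ht0).mpr hb
      rw [hI, Finset.mem_Icc]
      exact abs_le.mp hb'
    · simp only [hF, Set.Finite.mem_toFinset, Set.mem_ofPred_eq, hM, he']
      rw [Int.mul_ediv_cancel_left _ (by positivity), Zsqrtd.norm_def]
      ring
  · have hA6 : A.card ≤ 6 := Finset.card_le_six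
    have ht1 : (1 : ℝ) ≤ t := by exact_mod_cast ht.one_le
    have hFcard : ∀ a b, ((F a b).card : ℝ) ≤ K * (t : ℝ) ^ δ := by
      intro a b
      have h1 : (F a b).card = {z : GaussianInt | z.norm = M a b}.ncard :=
        (Set.ncard_eq_toFinset_card _ _).symm
      have h2 : (M a b : ℝ) ≤ (t : ℝ) ^ 4 := by
        have h3 : M a b ≤ (t : ℤ) ^ 4 := by
          have h4 : ((N : ℤ) ^ 2 - a ^ 2) / t ^ 2 ≤ t ^ 4 := by
            refine Int.ediv_le_of_le_mul (by positivity) ?_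
            have h5 : (N : ℤ) ≤ t ^ 2 := by exact_mod_cast hNt
            have h6 : (1 : ℤ) ≤ t ^ 2 := by nlinarith
            have h7 : (N : ℤ) ^ 2 ≤ (t ^ 2) ^ 2 := by gcongr
            nlinarith [sq_nonneg a, mul_le_mul_of_nonneg_left h6 (sq_nonneg ((t : ℤ) ^ 2))]
          simp only [hM]
          linarith [sq_nonneg b]
        exact_mod_cast h3
      have h3 := h (M a b) ((t : ℝ) ^ 4) (one_le_pow₀ ht1) h2
      rw [h1]
      refine h3.trans_eq ?_
      rw [← Real.rpow_natCast, ← Real.rpow_mul (by positivity)]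
      congr 2
      push_cast; ring
    have hIcard : (I.card : ℝ) ≤ 2 * (N / t + 1) := by
      have h1 : I.card = 2 * (N / t) + 1 := by
        rw [hI, Int.card_Icc]; omega
      have h2 : ((N / t : ℕ) : ℝ) ≤ N / t := Nat.cast_div_le
      rw [h1]; push_cast at h2 ⊢; linarith
    calc ((A.biUnion fun a => I.biUnion fun b => (F a b).image fun z =>
          (⟨a, t * b, t * z.re, t * z.im⟩ : ℍ[ℤ])).card : ℝ)
        ≤ ∑ a ∈ A, ∑ b ∈ I, ((F a b).card : ℝ) := by
          have h1 : (A.biUnion fun a => I.biUnion fun b => (F a b).image fun z =>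
              (⟨a, t * b, t * z.re, t * z.im⟩ : ℍ[ℤ])).card ≤ ∑ a ∈ A, ∑ b ∈ I, (F a b).card :=
            Finset.card_biUnion_le.trans (Finset.sum_le_sum fun a _ =>
              Finset.card_biUnion_le.trans (Finset.sum_le_sum fun b _ => Finset.card_image_le))
          exact_mod_cast h1
      _ ≤ ∑ a ∈ A, ∑ b ∈ I, K * (t : ℝ) ^ δ :=
          Finset.sum_le_sum fun a _ => Finset.sum_le_sum fun b _ => hFcard a b
      _ = A.card * (I.card * (K * (t : ℝ) ^ δ)) := by simp
      _ ≤ 6 * (2 * (N / t + 1) * (K * (t : ℝ) ^ δ)) := by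
          have : (A.card : ℝ) ≤ 6 := by exact_mod_cast hA6
          gcongr
      _ = _ := by ring

/-! ### The orders of the groups -/

theorem card_dsvGroup_le (q t : ℕ) [Fact t.Prime] : Nat.card (dsvGroup q t) ≤ t ^ 3 := by
  have ht : 1 < t := (Fact.out : t.Prime).one_lt
  have : Finite PGL(2, ZMod t) :=
    Finite.of_surjective _ (Matrix.ProjGenLinGroup.mk_surjective (n := Fin 2) (R := ZMod t))
  have hGL : Nat.card (GL (Fin 2) (ZMod t)) = (t ^ 2 - 1) * (t ^ 2 - t) := by
    rw [Matrix.card_GL_field]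
    simp [Fin.prod_univ_two, ZMod.card]
  have hcenter : Nat.card (Subgroup.center (GL (Fin 2) (ZMod t))) = t - 1 := by
    rw [Matrix.GeneralLinearGroup.center_eq_range_scalar]
    have hinj : Function.Injective (Matrix.GeneralLinearGroup.scalar (Fin 2) (R := ZMod t)) := by
      intro a b h
      have h' : Matrix.scalar (Fin 2) (a : ZMod t) = Matrix.scalar (Fin 2) (b : ZMod t) :=
        congrArg Units.val h
      exact Units.ext (Matrix.scalar_inj.mp h')
    rw [← Nat.card_congr (MonoidHom.ofInjective hinj).toEquiv, Nat.card_eq_fintype_card,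
      ZMod.card_units]
  have hmul : Nat.card (GL (Fin 2) (ZMod t)) =
      Nat.card PGL(2, ZMod t) * Nat.card (Subgroup.center (GL (Fin 2) (ZMod t))) :=
    Subgroup.card_eq_card_quotient_mul_card_subgroup _
  rw [hGL, hcenter] at hmul
  have hPGL : Nat.card PGL(2, ZMod t) ≤ t ^ 3 := by
    refine Nat.le_of_mul_le_mul_right (c := t - 1) ?_ (by omega)
    rw [← hmul]
    obtain ⟨s, rfl⟩ : ∃ s, t = s + 1 := ⟨t - 1, by omega⟩
    have h1 : (s + 1) ^ 2 - (s + 1) = (s + 1) * s := by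
      rw [Nat.sub_eq_iff_eq_add (by nlinarith)]; ring
    rw [h1, Nat.add_sub_cancel]
    calc ((s + 1) ^ 2 - 1) * ((s + 1) * s) ≤ (s + 1) ^ 2 * ((s + 1) * s) :=
          Nat.mul_le_mul_right _ (Nat.sub_le _ _)
      _ = _ := by ring
  exact (Nat.card_le_card_of_injective _ (dsvGroup q t).subtype_injective).trans hPGL

/-- The upper unitriangular matrices give `t` elements of the group. -/
theorem le_card_dsvGroup (q t : ℕ) [Fact t.Prime] : t ≤ Nat.card (dsvGroup q t) := by
  set M : ZMod t → Matrix.SpecialLinearGroup (Fin 2) (ZMod t) := fun b =>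
    ⟨!![1, b; 0, 1], by simp [Matrix.det_fin_two]⟩ with hM
  have hmem : ∀ b, Matrix.ProjGenLinGroup.mk (Matrix.SpecialLinearGroup.toGL (M b)) ∈
      dsvGroup q t := by
    intro b
    unfold dsvGroup
    split_ifs
    · exact ⟨(M b : Matrix.ProjectiveSpecialLinearGroup (Fin 2) (ZMod t)),
        Matrix.ProjectiveSpecialLinearGroup.toPGL_mk _⟩
    · trivial
  have hinj : Function.Injective fun b : ZMod t => (⟨_, hmem b⟩ : dsvGroup q t) := by
    intro b b' h
    have h' := congrArg Subtype.val h
    simp only [Matrix.ProjGenLinGroup.mk_eq_mk_iff] at h'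
    obtain ⟨u, hu⟩ := h'
    have hu' : (M b).1 * Matrix.scalar (Fin 2) (u : ZMod t) = (M b').1 := congrArg Units.val hu
    have h00 := congrFun (congrFun hu' 0) 0
    have h01 := congrFun (congrFun hu' 0) 1
    simp [hM] at h00 h01
    simpa [h00] using h01
  have := Nat.card_le_card_of_injective _ hinj
  simpa using this

/-! ### Counting large eigenvalues -/

theorem pValueCount_mul_pow_le {c : ℕ} (hc : 1 ≤ c) (X : FiniteRegularGraph (c + 1)) {p : ENNReal}
    (hp : 2 < p) (k : ℕ) :
    (pValueCount X p : ℝ) * (((c : ℝ) ^ (1 - (p⁻¹).toReal)) ^ k) ^ 2 ≤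
      ∑ i, heckeSeq c (((c + 1 : ℕ) : ℝ) * X.eigenvalue i) k ^ 2 := by
  classical
  have hc0 : (0 : ℝ) < c := by exact_mod_cast hc
  have hc1 : (1 : ℝ) ≤ c := by exact_mod_cast hc
  set P : X.V → Prop := fun i => ∃ r : ENNReal, IsPValue c (X.eigenvalue i) r ∧ p ≤ r
  have hcard : pValueCount X p = (Finset.univ.filter P).card := by
    rw [pValueCount, Nat.card_eq_fintype_card, Fintype.card_subtype]
  rw [hcard, ← nsmul_eq_mul]
  refine le_trans (Finset.card_nsmul_le_sum _ (fun i =>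
    heckeSeq c (((c + 1 : ℕ) : ℝ) * X.eigenvalue i) k ^ 2) _ ?_)
    (Finset.sum_le_sum_of_subset_of_nonneg (Finset.filter_subset _ _) fun i _ _ => sq_nonneg _)
  intro i hi
  obtain ⟨r, hr, hpr⟩ := (Finset.mem_filter.mp hi).2
  rcases hr with ⟨-, rfl⟩ | ⟨-, h2r, hr⟩
  · exact absurd (hp.trans_le hpr) (lt_irrefl _)
  have hrp : (r⁻¹).toReal ≤ (p⁻¹).toReal := by
    refine ENNReal.toReal_mono ?_ (ENNReal.inv_le_inv.mpr hpr)
    exact ENNReal.inv_ne_top.mpr (zero_lt_two.trans hp).ne'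
  rw [← sq_abs (heckeSeq c _ k)]
  have habs : |((c + 1 : ℕ) : ℝ) * X.eigenvalue i| =
      (c : ℝ) ^ (1 - (r⁻¹).toReal) + (c : ℝ) ^ (r⁻¹).toReal := by
    rw [abs_mul, hr, Nat.abs_cast]
    push_cast
    field_simp
    rw [add_comm]
  have hxy : (c : ℝ) ^ (1 - (r⁻¹).toReal) * (c : ℝ) ^ (r⁻¹).toReal = c := by
    rw [← Real.rpow_add hc0]; simp
  have key := pow_le_abs_heckeSeq (by positivity) (by positivity) hxy habs k
  refine pow_le_pow_left₀ (by positivity) (le_trans ?_ key) 2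
  gcongr

/-- Second moments of the Hecke recursion are controlled by the first moments of even index. -/
theorem sum_heckeSeq_sq_le {ι : Type*} [Fintype ι] {c : ℕ} (hc : 1 ≤ c) (l : ι → ℝ) {W τ : ℝ}
    (hW : 0 ≤ W) (hτ : 0 < τ) (k : ℕ)
    (h : ∀ j ≤ k, ∑ i, heckeSeq c (l i) (2 * j) ≤ W * ((c : ℝ) ^ (2 * j) / τ + 1)) :
    ∑ i, heckeSeq c (l i) k ^ 2 ≤ (k + 1) * W * ((c : ℝ) ^ (2 * k) / τ + (c : ℝ) ^ k) := by
  have hc1 : (1 : ℝ) ≤ c := by exact_mod_cast hc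
  induction k with
  | zero =>
    have := h 0 le_rfl
    simpa [heckeSeq] using this
  | succ k ih =>
    have ih' := ih fun j hj => h j (by omega)
    have h1 := h (k + 1) le_rfl
    simp_rw [heckeSeq_succ_sq, Finset.sum_add_distrib, ← Finset.mul_sum]
    have h2 : (c : ℝ) * ((k + 1) * W * ((c : ℝ) ^ (2 * k) / τ + (c : ℝ) ^ k)) ≤
        (k + 1) * W * ((c : ℝ) ^ (2 * (k + 1)) / τ + (c : ℝ) ^ (k + 1)) := by
      have h3 : (c : ℝ) * (c : ℝ) ^ (2 * k) ≤ (c : ℝ) ^ (2 * (k + 1)) := by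
        rw [← pow_succ']; exact pow_le_pow_right₀ hc1 (by omega)
      calc (c : ℝ) * ((k + 1) * W * ((c : ℝ) ^ (2 * k) / τ + (c : ℝ) ^ k))
          = (k + 1) * W * (c * (c : ℝ) ^ (2 * k) / τ + (c : ℝ) ^ (k + 1)) := by ring
        _ ≤ _ := by gcongr
    have h4 : W * ((c : ℝ) ^ (2 * (k + 1)) / τ + 1) ≤
        W * ((c : ℝ) ^ (2 * (k + 1)) / τ + (c : ℝ) ^ (k + 1)) := by
      have := one_le_pow₀ (n := k + 1) hc1
      gcongr
    have h5 := mul_le_mul_of_nonneg_left ih' (by positivity : (0 : ℝ) ≤ c)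
    push_cast
    linarith

theorem mainTheorem7 (q q' : ℕ) (hq : q.Prime) (hq2 : 2 < q)
    (hq' : √(q : ℝ) + 1 ≤ (q' : ℝ) + 1) :
    SarnakXueDensity (dsvSubsetFamily q q') (1 / 3) := by
  classical
  have hqq : q ≤ q' ^ 2 := by
    have h1 : √(q : ℝ) ≤ q' := by linarith
    have h2 := (Real.sqrt_le_left (by positivity)).mp h1
    exact_mod_cast h2
  have hq'2 : 1 < q' := by
    by_contra! h
    nlinarith
  have hc1 : (1 : ℝ) ≤ q' := by exact_mod_cast hq'2.le
  have : Fact q.Prime := ⟨hq⟩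
  intro ε hε
  -- factors `t ^ δ` come from the quaternions and twice from `k + 1`, hence `δ = ε / 3`
  obtain ⟨K, hK, hcount⟩ := exists_card_scalar_quaternions_le (δ := ε / 3) (by linarith)
  obtain ⟨L, hL, hdiv⟩ := exists_card_divisors_le (δ := ε / 3) (by linarith)
  refine ⟨2 * K * L ^ 2 * q' ^ 2, ?_⟩
  rintro X ⟨t, ht0, x, y, S, hS, hd, ht, ht2, htq, hxy, hgen, rfl⟩ p hp
  have : Fact t.Prime := ⟨ht⟩
  set X := cayleyGraph S hS hd with hX
  have horder : X.order = Nat.card (dsvGroup q t) :=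
    (Nat.card_eq_fintype_card (α := X.V)).symm
  set n := Nat.card (dsvGroup q t) with hn
  have hnt : (n : ℝ) ≤ (t : ℝ) ^ 3 := by exact_mod_cast card_dsvGroup_le q t
  have htn : (t : ℝ) ≤ n := by exact_mod_cast le_card_dsvGroup q t
  have ht1 : (1 : ℝ) ≤ t := by exact_mod_cast ht.one_le
  have hn1 : (1 : ℝ) ≤ n := ht1.trans htn
  -- the length of the words: `q' ^ k ≤ t < q' ^ (k + 1)`
  set k := Nat.log q' t with hk
  have hkt : (q' : ℝ) ^ k ≤ t := by exact_mod_cast Nat.pow_log_le_self q' ht.ne_zero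
  have htk : (t : ℝ) ≤ (q' : ℝ) ^ k * q' := by
    rw [← pow_succ]
    exact_mod_cast (Nat.lt_pow_succ_log_self hq'2 t).le
  set a := (p⁻¹).toReal with ha
  have ha0 : 0 ≤ a := ENNReal.toReal_nonneg
  have ha2 : a ≤ 1 / 2 := by
    have h1 : p⁻¹ ≤ 2⁻¹ := ENNReal.inv_le_inv.mpr hp.le
    have h2 := ENNReal.toReal_mono (by simp) h1
    simpa [ha] using h2
  -- `k + 1` is the number of divisors of `2 ^ k ≤ t`
  have hk1 : (k + 1 : ℝ) ≤ L * (t : ℝ) ^ (ε / 3) := by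
    have h1 := hdiv (2 ^ k) (by positivity)
    rw [Nat.divisors_prime_pow Nat.prime_two] at h1
    simp only [Finset.card_map, Finset.card_range] at h1
    push_cast at h1
    refine h1.trans ?_
    have h2 : (2 : ℝ) ^ k ≤ t := by
      refine le_trans ?_ hkt
      have : (2 : ℝ) ≤ q' := by exact_mod_cast hq'2
      gcongr
    gcongr
  -- closed reduced words of length `2 i`
  have hword : ∀ i ≤ k, (sphereCount S (2 * i) 1 : ℝ) ≤
      K * (t : ℝ) ^ (ε / 3) * ((q' : ℝ) ^ (2 * i) / t + 1) := by
    intro i hi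
    have hqi : q ^ i ≤ q' ^ (2 * i) := by
      rw [pow_mul]; exact Nat.pow_le_pow_left hqq i
    have hit : q ^ i ≤ t ^ 2 := by
      refine hqi.trans ?_
      rw [mul_comm, pow_mul]
      refine Nat.pow_le_pow_left ?_ 2
      exact (Nat.pow_le_pow_right hq'2.le hi).trans (Nat.pow_log_le_self q' ht.ne_zero)
    have htqi : ¬t ∣ q ^ i := fun h =>
      htq ((Nat.prime_dvd_prime_iff_eq ht hq).mp (ht.dvd_of_dvd_pow h))
    obtain ⟨T, hT, hTcard⟩ := hcount t (q ^ i) ht ht2 (pow_pos hq.pos i) htqi hit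
    have h1 : sphereCount S (2 * i) 1 ≤ T.card := by
      refine sphereCount_one_le_card hq2 ht2 htq hxy hgen (2 * i) T fun e he => hT e ?_
      rw [he]; push_cast; ring
    have h2 : ((q ^ i : ℕ) : ℝ) ≤ (q' : ℝ) ^ (2 * i) := by exact_mod_cast hqi
    calc (sphereCount S (2 * i) 1 : ℝ) ≤ T.card := by exact_mod_cast h1
      _ ≤ _ := hTcard
      _ ≤ _ := by gcongr
  have htrace : ∀ j ≤ k, ∑ i, heckeSeq q' (((q' + 1 : ℕ) : ℝ) * X.eigenvalue i) (2 * j) ≤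
      n * ((k + 1) * (K * (t : ℝ) ^ (ε / 3))) * ((q' : ℝ) ^ (2 * j) / t + 1) := by
    intro j hj
    rw [hX, sum_heckeSeq_cayleyGraph hS hd, sphereCountSum_two_mul, mul_assoc (n : ℝ)]
    refine mul_le_mul_of_nonneg_left ?_ (by positivity)
    push_cast
    calc ∑ i ∈ Finset.range (j + 1), (sphereCount S (2 * i) 1 : ℝ)
        ≤ ∑ i ∈ Finset.range (j + 1), K * (t : ℝ) ^ (ε / 3) * ((q' : ℝ) ^ (2 * j) / t + 1) := by
          refine Finset.sum_le_sum fun i hi => ?_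
          rw [Finset.mem_range] at hi
          refine (hword i (by omega)).trans ?_
          have : (q' : ℝ) ^ (2 * i) ≤ (q' : ℝ) ^ (2 * j) := pow_le_pow_right₀ hc1 (by omega)
          gcongr
      _ = (j + 1) * (K * (t : ℝ) ^ (ε / 3)) * ((q' : ℝ) ^ (2 * j) / t + 1) := by
          simp; ring
      _ ≤ _ := by
          have : (j : ℝ) ≤ k := by exact_mod_cast hj
          gcongr
  have hmom := sum_heckeSeq_sq_le hq'2.le _ (by positivity) (by positivity : (0 : ℝ) < t) k htrace
  have hcountp := (pValueCount_mul_pow_le hq'2.le X hp k).trans hmom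
  have hup : (k + 1) * (n * ((k + 1) * (K * (t : ℝ) ^ (ε / 3)))) *
      ((q' : ℝ) ^ (2 * k) / t + (q' : ℝ) ^ k) ≤
      2 * K * L ^ 2 * n * (t : ℝ) ^ ε * t := by
    have h1 : (q' : ℝ) ^ (2 * k) / t + (q' : ℝ) ^ k ≤ 2 * t := by
      have : (q' : ℝ) ^ (2 * k) / t ≤ t := by
        rw [div_le_iff₀ (by positivity), mul_comm, pow_mul, ← sq]
        gcongr
      linarith
    have h2 : (t : ℝ) ^ ε = (t : ℝ) ^ (ε / 3) * (t : ℝ) ^ (ε / 3) * (t : ℝ) ^ (ε / 3) := by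
      rw [← Real.rpow_add (by positivity), ← Real.rpow_add (by positivity)]
      congr 1; ring
    calc (k + 1) * (n * ((k + 1) * (K * (t : ℝ) ^ (ε / 3)))) *
          ((q' : ℝ) ^ (2 * k) / t + (q' : ℝ) ^ k)
        ≤ (L * (t : ℝ) ^ (ε / 3)) * (n * ((L * (t : ℝ) ^ (ε / 3)) * (K * (t : ℝ) ^ (ε / 3)))) *
          (2 * t) := by gcongr
      _ = _ := by rw [h2]; ring
  have hlow : (t : ℝ) ^ (2 - 2 * a) ≤ (((q' : ℝ) ^ (1 - a)) ^ k) ^ 2 * q' ^ 2 := by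
    have h1 : (((q' : ℝ) ^ (1 - a)) ^ k) ^ 2 = ((q' : ℝ) ^ k) ^ (2 - 2 * a) := by
      rw [← Real.rpow_natCast, ← Real.rpow_natCast, ← Real.rpow_natCast,
        ← Real.rpow_mul (by positivity), ← Real.rpow_mul (by positivity),
        ← Real.rpow_mul (by positivity)]
      congr 1; push_cast; ring
    have h2 : (q' : ℝ) ^ (2 - 2 * a) ≤ (q' : ℝ) ^ 2 := by
      rw [← Real.rpow_natCast]
      exact Real.rpow_le_rpow_of_exponent_le hc1 (by push_cast; linarith)
    calc (t : ℝ) ^ (2 - 2 * a) ≤ ((q' : ℝ) ^ k * q') ^ (2 - 2 * a) :=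
          Real.rpow_le_rpow (by positivity) htk (by linarith)
      _ = ((q' : ℝ) ^ k) ^ (2 - 2 * a) * (q' : ℝ) ^ (2 - 2 * a) :=
          Real.mul_rpow (by positivity) (by positivity)
      _ ≤ _ := by rw [h1]; gcongr
  have hmain : (pValueCount X p : ℝ) * (t : ℝ) ^ (2 - 2 * a) ≤
      2 * K * L ^ 2 * q' ^ 2 * (n * (t : ℝ) ^ ε * t) := by
    calc (pValueCount X p : ℝ) * (t : ℝ) ^ (2 - 2 * a)
        ≤ (pValueCount X p : ℝ) * ((((q' : ℝ) ^ (1 - a)) ^ k) ^ 2 * q' ^ 2) := by gcongr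
      _ = ((pValueCount X p : ℝ) * (((q' : ℝ) ^ (1 - a)) ^ k) ^ 2) * q' ^ 2 := by ring
      _ ≤ (2 * K * L ^ 2 * n * (t : ℝ) ^ ε * t) * q' ^ 2 := by
          have := hcountp.trans hup
          gcongr
      _ = _ := by ring
  -- `n ≤ t ^ 3` turns the saving `t ^ (-(1 - 2 a))` into `n ^ (-(1 - 2 a) / 3)`
  have hsave : (n : ℝ) ^ (1 / 3 * (1 - 2 * a)) ≤ (t : ℝ) ^ (1 - 2 * a) := by
    calc (n : ℝ) ^ (1 / 3 * (1 - 2 * a)) ≤ ((t : ℝ) ^ 3) ^ (1 / 3 * (1 - 2 * a)) :=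
          Real.rpow_le_rpow (by positivity) hnt (by nlinarith)
      _ = _ := by
          rw [← Real.rpow_natCast, ← Real.rpow_mul (by positivity)]
          congr 1; push_cast; ring
  have hsplit : (t : ℝ) ^ (2 - 2 * a) = t * (t : ℝ) ^ (1 - 2 * a) := by
    rw [← Real.rpow_one_add' (by positivity) (by linarith)]
    congr 1; ring
  have hcount' : (pValueCount X p : ℝ) * (n : ℝ) ^ (1 / 3 * (1 - 2 * a)) ≤
      2 * K * L ^ 2 * q' ^ 2 * (n * (n : ℝ) ^ ε) := by
    have h1 : (pValueCount X p : ℝ) * (t : ℝ) ^ (1 - 2 * a) ≤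
        2 * K * L ^ 2 * q' ^ 2 * (n * (t : ℝ) ^ ε) := by
      rw [hsplit] at hmain
      refine le_of_mul_le_mul_right ?_ (by positivity : (0 : ℝ) < t)
      linarith
    calc _ ≤ _ := by gcongr
      _ ≤ _ := h1
      _ ≤ _ := by gcongr
  rw [horder]
  have hexp : (n : ℝ) ^ (1 - 1 / 3 * (1 - 2 * a) + ε) =
      n * (n : ℝ) ^ ε / (n : ℝ) ^ (1 / 3 * (1 - 2 * a)) := by
    rw [show 1 - 1 / 3 * (1 - 2 * a) + ε = 1 + ε - 1 / 3 * (1 - 2 * a) by ring,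
      Real.rpow_sub (by positivity), Real.rpow_add (by positivity), Real.rpow_one]
  rw [hexp, ← mul_div_assoc, le_div_iff₀ (by positivity)]
  exact hcount'

end
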